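/- **Setting.** There are $N\ge 4$ non-colluding databases and a model of $M\ge1$ submodels, each with $L\ge1$ parameters in a finite field $\mathbb F_q$. Database $n$ has capacity $\mu(n)ML$ symbols, with $\mu(n)\in(0,1]$. The storage constraints are heterogeneous: $\mu(m)\ne\mu(n)$ for some $m,n$. Entropies are in units of $\log q$. A *storage mechanism with a PRUW (private read-update-write) scheme* works as follows. The initial contents $S_n^{[0]}$ of the databases are functions of the model $W^{[0]}$ and of uniform random symbols. In round $t=1,2,\dots$ a user with submodel index $\theta^{[t]}$, update $\Delta^{[t]}\in\mathbb F_q^L$ and fresh uniform random symbols sends a query $Q_n^{[t]}$ (a function of $\theta^{[t]}$ and of these random symbols) to each database $n$. The user receives an answer $A_n^{[t]}$ that is a function of $S_n^{[t-1]}$ and $Q_n^{[t]}$, and sends an upload $U_n^{[t]}$. Database $n$ then replaces $S_n^{[t-1]}$ by a function $S_n^{[t]}$ of $S_n^{[t-1]},Q_n^{[t]},U_n^{[t]}$. The model $W^{[t]}$ is $W^{[t-1]}$ with $\Delta^{[t]}$ added to submodel $\theta^{[t]}$. For every number $T$ of rounds, every joint law of $(W^{[0]},\theta^{[1:T]},\Delta^{[1:T]})$,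 independent of the random symbols, and every database $n$, the following is required: * privacy of the index and of the updates, and security of the model: $I(\theta^{[1:T]};V_n)=I(\Delta^{[1:T]};V_n)=I(W^{[0:T]};V_n)=0$, where $V_n=(Q_n^{[1:T]},U_n^{[1:T]},S_n^{[0:T]})$; * correctness of reading: $H\big(W_{\theta^{[t]}}^{[t-1]}\,\big|\,Q_{1:N}^{[t]},A_{1:N}^{[t]}\big)=0$ for $1\le t\le T$; * correctness of writing: $H\big(W^{[t]}\,\big|\,S_{1:N}^{[t]}\big)=0$ for $0\le t\le T$. The total cost is $(\mathcal D+\mathcal U)/L$, where $\mathcal D$ is the number of symbols downloaded in the reading phase of a round and $\mathcal U$ the number of symbols uploaded in its writing phase (the vectors $U_n$). **Costs.** Let $k=\frac1{\max_n\mu(n)}$, $p=\sum_{n}\mu(n)$, $r=kp$, $s=\lfloor k\rfloor p$, and for integers $a,b\ge0$ $$C_T(a,b)=\begin{cases}\frac{4b}{b-a-1},& b-a\text{ odd},\ a\le b-3,\\ \frac{4b-2}{b-a-2},& b-a\text{ even},\ a\le b-4,\\ \infty,&\text{otherwise.}\end{cases}$$ Put (with $0\cdot\infty=0$, and with $0$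 in place of negative weights, which occur only if $C_1=C_2=\infty$) $$C_1=(\lfloor s\rfloor+1-s)\,C_T(\lfloor k\rfloor,\lfloor s\rfloor)+(s-\lfloor s\rfloor)\,C_T(\lfloor k\rfloor,\lceil s\rceil),$$ $$C_2=\alpha\beta C_T(\lfloor k\rfloor,\lfloor r\rfloor)+\alpha(1-\beta)C_T(\lfloor k\rfloor,\lceil r\rceil)+(1-\alpha)\delta C_T(\lceil k\rceil,\lfloor r\rfloor)+(1-\alpha)(1-\delta)C_T(\lceil k\rceil,\lceil r\rceil).$$ If $\lfloor r\rfloor-\lfloor k\rfloor$ is odd, then $$\alpha=\begin{cases}\frac{\lfloor k\rfloor(p\lceil k\rceil-\lceil r\rceil)}{\lceil k\rceil\lfloor r\rfloor-\lfloor k\rfloor\lceil r\rceil},& r-\lfloor r\rfloor>k-\lfloor k\rfloor,\ s\le\lfloor r\rfloor,\\ \frac{\lfloor k\rfloor}{k}(\lceil k\rceil-k),&\text{else,}\end{cases}$$ $$\beta=\begin{cases}\frac{\lceil r\rceil-r}{\lceil k\rceil-k},& r-\lfloor r\rfloor>k-\lfloor k\rfloor,\ s>\lfloor r\rfloor,\\1,&\text{else,}\end{cases}\qquad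 \delta=\begin{cases}1-\frac{r-\lfloor r\rfloor}{k-\lfloor k\rfloor},& r-\lfloor r\rfloor\le k-\lfloor k\rfloor,\\0,&\text{else.}\end{cases}$$ If $\lfloor r\rfloor-\lfloor k\rfloor$ is even, then $\delta=1$ and $$\alpha=\begin{cases}\frac{\lfloor k\rfloor}{k}(\lceil k\rceil-k),& r-\lfloor r\rfloor<\lceil k\rceil-k,\\ \frac{\lfloor k\rfloor(p\lceil k\rceil-\lfloor r\rfloor)}{\lceil k\rceil\lceil r\rceil-\lfloor k\rfloor\lfloor r\rfloor},&\text{else,}\end{cases}\qquad \beta=\begin{cases}1-\frac{r-\lfloor r\rfloor}{\lceil k\rceil-k},& r-\lfloor r\rfloor<\lceil k\rceil-k,\\0,&\text{else.}\end{cases}$$ A quotient with denominator $0$, which can matter only when $k$ is an integer, is read as $0$. Let $\mathcal C=\min\{C_1,C_2\}$. **Theorem.** Suppose $\mathcal C<\infty$. There is $q_0$, depending only on $N$ and $\mu$, such that the following hold. 1. If all $\mu(n)$ are rational, there is $L_0\ge1$ such that for all $M\ge 1$, all positive multiples $L$ of $L_0$ and all finite fields with $q\ge q_0$, there are a storage mechanism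 and a PRUW scheme as above with total cost exactly $\mathcal C$ that completely fill the databases: database $n$ stores exactly $\mu(n)ML$ symbols, and $H(S_n^{[t]})=\mu(n)ML$ at all times $t$. 2. For arbitrary real $\mu(n)$ and every $\varepsilon>0$ there is $L_0\ge1$ such that for all $M\ge 1$, all positive multiples $L$ of $L_0$ and all finite fields with $q\ge q_0$, there are a storage mechanism and a PRUW scheme as above with total cost within $\varepsilon$ of $\mathcal C$, in which the number of symbols stored in database $n$ is within $\varepsilon ML$ of $\mu(n)ML$ and equals $H(S_n^{[t]})$ at all times $t$. -/

import Mathlib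

open scoped ENNReal

noncomputable section

namespace PRUW

/-! ### Shannon entropy of finitely valued random variables -/

section Entropy

variable {Ω α β : Type} [Fintype α] [Fintype β]

/-- Shannon entropy `H(X)`, in units of `log q`, of a random variable `X` on the discrete
probability space `(Ω, P)`. -/
def entropy (q : ℕ) (P : PMF Ω) (X : Ω → α) : ℝ :=
  (∑ a, Real.negMulLog ((P.map X) a).toReal) / Real.log q

/-- Conditional entropy `H(X | Y) = H(X, Y) - H(Y)`. -/
def condEntropy (q : ℕ) (P : PMF Ω) (X : Ω → α) (Y : Ω → β) : ℝ :=
  entropy q P (fun ω => (X ω, Y ω)) - entropy q P Y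

/-- Mutual information `I(X; Y) = H(X) + H(Y) - H(X, Y)`. -/
def mutualInfo (q : ℕ) (P : PMF Ω) (X : Ω → α) (Y : Ω → β) : ℝ :=
  entropy q P X + entropy q P Y - entropy q P (fun ω => (X ω, Y ω))

end Entropy

/-! ### Private read-update-write schemes -/

/-- The model: `M` submodels of `L` parameters each. -/
abbrev Model (F : Type) (M L : ℕ) : Type := Fin M → Fin L → F

/-- The data of `T` rounds: the initial model, the index of the submodel that is read and
updated in each round, and the update of each round. -/
abbrev Inputs (F : Type) (M L T : ℕ) : Type :=
  Model F M L × (Fin T → Fin M) × (Fin T → Fin L → F)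

/-- The model `W^[t]` after `t` rounds: round number `t + 1` adds its update to the submodel
that it addresses and leaves all the other submodels unchanged. -/
def modelAt {F : Type} [Field F] {M L T : ℕ} (i : Inputs F M L T) : ℕ → Model F M L
  | 0 => i.1
  | t + 1 => fun m =>
      if h : t < T then
        if m = i.2.1 ⟨t, h⟩ then modelAt i t m + i.2.2 ⟨t, h⟩ else modelAt i t m
      else modelAt i t m

/-- The storage mechanism and the read-write protocol of a system of `N` databases, for `M`
submodels of `L` parameters in `F`. All lengths count symbols of `F`. -/
structure Scheme (F : Type) (N M L : ℕ) where
  /-- number of symbols stored in each database -/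
  storeLen : Fin N → ℕ
  /-- length of the query sent to each database in the reading phase -/
  queryLen : Fin N → ℕ
  /-- number of symbols downloaded from each database in the reading phase -/
  ansLen : Fin N → ℕ
  /-- number of symbols uploaded to each database in the writing phase -/
  updLen : Fin N → ℕ
  /-- number of random symbols used for the initial storage -/
  storeNoiseLen : ℕ
  /-- number of random symbols used by the user of a round -/
  userNoiseLen : ℕ
  /-- initial contents of the databases -/
  encode : Model F M L → (Fin storeNoiseLen → F) → ∀ n, Fin (storeLen n) → F
  /-- queries, from the index of the required submodel and the randomness of the user -/
  query : Fin M → (Fin userNoiseLen → F) → ∀ n, Fin (queryLen n) → F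
  /-- answer of a database, from its own contents and its own query -/
  answer : ∀ n, (Fin (storeLen n) → F) → (Fin (queryLen n) → F) → Fin (ansLen n) → F
  /-- uploads of the writing phase, from the index of the submodel, the update and the
  randomness of the user -/
  upload : Fin M → (Fin L → F) → (Fin userNoiseLen → F) → ∀ n, Fin (updLen n) → F
  /-- new contents of a database, from its own contents, query and upload -/
  write : ∀ n, (Fin (storeLen n) → F) → (Fin (queryLen n) → F) → (Fin (updLen n) → F) →
    Fin (storeLen n) → F

namespace Scheme

variable {F : Type} [Field F] [Fintype F] {N M L : ℕ} (P : Scheme F N M L) {T : ℕ}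

/-- Sample space of `T` rounds: the data, the randomness of the initial storage, and the
randomness of the user of each round. -/
abbrev Outcome (P : Scheme F N M L) (T : ℕ) : Type :=
  Inputs F M L T × (Fin P.storeNoiseLen → F) × (Fin T → Fin P.userNoiseLen → F)

/-- The data follow the joint law `D`; all the random symbols of the scheme are uniform,
mutually independent and independent of the data. -/
def law (D : PMF (Inputs F M L T)) : PMF (P.Outcome T) :=
  D.bind fun i =>
    (PMF.uniformOfFintype ((Fin P.storeNoiseLen → F) × (Fin T → Fin P.userNoiseLen → F))).map
      fun z => (i, z)

/-- Query `Q_n` of a round. -/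
def queryAt (ω : P.Outcome T) (t : Fin T) (n : Fin N) : Fin (P.queryLen n) → F :=
  P.query (ω.1.2.1 t) (ω.2.2 t) n

/-- Upload `U_n` of a round. -/
def uploadAt (ω : P.Outcome T) (t : Fin T) (n : Fin N) : Fin (P.updLen n) → F :=
  P.upload (ω.1.2.1 t) (ω.1.2.2 t) (ω.2.2 t) n

/-- Contents `S_n^[t]` of database `n` after `t` rounds. -/
def storeAt (ω : P.Outcome T) (n : Fin N) : ℕ → Fin (P.storeLen n) → F
  | 0 => P.encode ω.1.1 ω.2.1 n
  | t + 1 =>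
      if h : t < T then
        P.write n (storeAt ω n t) (P.queryAt ω ⟨t, h⟩ n) (P.uploadAt ω ⟨t, h⟩ n)
      else storeAt ω n t

/-- Answer `A_n` of a round, computed from the contents before the round. -/
def answerAt (ω : P.Outcome T) (t : Fin T) (n : Fin N) : Fin (P.ansLen n) → F :=
  P.answer n (P.storeAt ω n t) (P.queryAt ω t n)

/-- All that database `n` sees in `T` rounds: `(Q_n^[1:T], U_n^[1:T], S_n^[0:T])`. -/
def view (n : Fin N) (ω : P.Outcome T) :
    (Fin T → Fin (P.queryLen n) → F) × (Fin T → Fin (P.updLen n) → F) ×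
      (Fin (T + 1) → Fin (P.storeLen n) → F) :=
  (fun t => P.queryAt ω t n, fun t => P.uploadAt ω t n, fun t => P.storeAt ω n t)

/-- The privacy, security and correctness requirements, for any number of rounds and any joint
law of the data. Round `t : Fin T` is the round from time `t` to time `t + 1`. -/
structure IsPRUW : Prop where
  /-- privacy of the submodel indices -/
  index_private : ∀ (T : ℕ) (D : PMF (Inputs F M L T)) (n : Fin N),
    mutualInfo (Fintype.card F) (P.law D) (fun ω => ω.1.2.1) (P.view n) = 0
  /-- privacy of the values of the updates -/
  update_private : ∀ (T : ℕ) (D : PMF (Inputs F M L T)) (n : Fin N),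
    mutualInfo (Fintype.card F) (P.law D) (fun ω => ω.1.2.2) (P.view n) = 0
  /-- security of the submodels -/
  model_secure : ∀ (T : ℕ) (D : PMF (Inputs F M L T)) (n : Fin N),
    mutualInfo (Fintype.card F) (P.law D)
      (fun ω => fun t : Fin (T + 1) => modelAt ω.1 (t : ℕ)) (P.view n) = 0
  /-- correctness of the reading phase: the queries and answers of a round determine the
  current value of the required submodel -/
  read_correct : ∀ (T : ℕ) (D : PMF (Inputs F M L T)) (t : Fin T),
    condEntropy (Fintype.card F) (P.law D)
      (fun ω => modelAt ω.1 (t : ℕ) (ω.1.2.1 t))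
      (fun ω => (P.queryAt ω t, P.answerAt ω t)) = 0
  /-- correctness of the writing phase: at any time the databases hold the model with all the
  updates so far -/
  write_correct : ∀ (T : ℕ) (D : PMF (Inputs F M L T)) (t : Fin (T + 1)),
    condEntropy (Fintype.card F) (P.law D)
      (fun ω => modelAt ω.1 (t : ℕ)) (fun ω => fun n => P.storeAt ω n (t : ℕ)) = 0

/-- At any time the contents of every database have the full entropy of the space they occupy:
`H(S_n^[t])` equals the number of stored symbols. -/
def IsFull : Prop :=
  ∀ (T : ℕ) (D : PMF (Inputs F M L T)) (t : Fin (T + 1)) (n : Fin N),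
    entropy (Fintype.card F) (P.law D) (fun ω => P.storeAt ω n (t : ℕ)) = P.storeLen n

/-- Reading cost: downloaded symbols per parameter of a submodel. -/
def readCost : ℝ := (∑ n, (P.ansLen n : ℝ)) / L

/-- Writing cost: symbols uploaded in the writing phase per parameter of a submodel. -/
def writeCost : ℝ := (∑ n, (P.updLen n : ℝ)) / L

/-- Total cost. -/
def totalCost : ℝ := P.readCost + P.writeCost

end Scheme

/-- The total cost `C` is achieved up to `ε` by databases with storage capacities `μ n * M * L`
that are filled up to `ε * M * L` symbols, over all fields with at least `q₀` elements, for any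
number `M` of submodels, and for any submodel size `L` that is a multiple of some `L₀`.
For `ε = 0` the databases are filled exactly and the cost is exactly `C`. -/
def AchievesUpTo {N : ℕ} (μ : Fin N → ℝ) (C : ℝ) (q₀ : ℕ) (ε : ℝ) : Prop :=
  ∃ L₀ : ℕ, 0 < L₀ ∧ ∀ M L : ℕ, 0 < M → 0 < L → L₀ ∣ L →
    ∀ (F : Type) [Field F] [Fintype F], q₀ ≤ Fintype.card F →
      ∃ P : Scheme F N M L, P.IsPRUW ∧ P.IsFull ∧
        (∀ n, |(P.storeLen n : ℝ) - μ n * M * L| ≤ ε * M * L) ∧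
        |P.totalCost - C| ≤ ε

/-! ### The costs -/

/-- `C_T(a, b)`, with the value `∞` when `(a, b)` coded storage is not usable, that is, unless
`a ≤ b - 3` for odd `b - a`, and `a ≤ b - 4` for even `b - a`. -/
def codeCost (a b : ℕ) : ℝ≥0∞ :=
  if Odd (b - a) ∧ a + 3 ≤ b then ENNReal.ofReal (4 * b / (b - a - 1))
  else if Even (b - a) ∧ a + 4 ≤ b then ENNReal.ofReal ((4 * b - 2) / (b - a - 2))
  else ∞

section Parameters

variable {N : ℕ} (μ : Fin N → ℝ)

/-- `k = 1 / max μ(n)` -/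
def kk : ℝ := 1 / ⨆ n, μ n

/-- `p = ∑ μ(n)` -/
def pp : ℝ := ∑ n, μ n

/-- `r = k p` -/
def rr : ℝ := kk μ * pp μ

/-- `s = ⌊k⌋ p` -/
def ss : ℝ := ⌊kk μ⌋₊ * pp μ

/-- `C₁`. For `s` not an integer the weight `⌊s⌋ + 1 - s` is `⌈s⌉ - s`; for an integer `s` all of
the model is `(⌊k⌋, s)` coded. -/
def cost₁ : ℝ≥0∞ :=
  ENNReal.ofReal (⌊ss μ⌋₊ + 1 - ss μ) * codeCost ⌊kk μ⌋₊ ⌊ss μ⌋₊ +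
    ENNReal.ofReal (ss μ - ⌊ss μ⌋₊) * codeCost ⌊kk μ⌋₊ ⌈ss μ⌉₊

/-- `⌊r⌋ - ⌊k⌋` is odd. -/
def OddCase : Prop := Odd ((⌊rr μ⌋₊ : ℤ) - (⌊kk μ⌋₊ : ℤ))

open Classical in
/-- the fraction `α` -/
def fracα : ℝ :=
  if OddCase μ then
    if rr μ - ⌊rr μ⌋₊ > kk μ - ⌊kk μ⌋₊ ∧ ss μ ≤ ⌊rr μ⌋₊ then
      ⌊kk μ⌋₊ * (pp μ * ⌈kk μ⌉₊ - ⌈rr μ⌉₊) /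
        (⌈kk μ⌉₊ * ⌊rr μ⌋₊ - ⌊kk μ⌋₊ * ⌈rr μ⌉₊)
    else ⌊kk μ⌋₊ / kk μ * (⌈kk μ⌉₊ - kk μ)
  else
    if rr μ - ⌊rr μ⌋₊ < ⌈kk μ⌉₊ - kk μ then
      ⌊kk μ⌋₊ / kk μ * (⌈kk μ⌉₊ - kk μ)
    else
      ⌊kk μ⌋₊ * (pp μ * ⌈kk μ⌉₊ - ⌊rr μ⌋₊) /
        (⌈kk μ⌉₊ * ⌈rr μ⌉₊ - ⌊kk μ⌋₊ * ⌊rr μ⌋₊)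

open Classical in
/-- the fraction `β` -/
def fracβ : ℝ :=
  if OddCase μ then
    if rr μ - ⌊rr μ⌋₊ > kk μ - ⌊kk μ⌋₊ ∧ ss μ > ⌊rr μ⌋₊ then
      (⌈rr μ⌉₊ - rr μ) / (⌈kk μ⌉₊ - kk μ)
    else 1
  else
    if rr μ - ⌊rr μ⌋₊ < ⌈kk μ⌉₊ - kk μ then
      1 - (rr μ - ⌊rr μ⌋₊) / (⌈kk μ⌉₊ - kk μ)
    else 0

open Classical in
/-- the fraction `δ` -/
def fracδ : ℝ :=
  if OddCase μ then
    if rr μ - ⌊rr μ⌋₊ ≤ kk μ - ⌊kk μ⌋₊ then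
      1 - (rr μ - ⌊rr μ⌋₊) / (kk μ - ⌊kk μ⌋₊)
    else 0
  else 1

/-- `C₂` -/
def cost₂ : ℝ≥0∞ :=
  ENNReal.ofReal (fracα μ * fracβ μ) * codeCost ⌊kk μ⌋₊ ⌊rr μ⌋₊ +
    ENNReal.ofReal (fracα μ * (1 - fracβ μ)) * codeCost ⌊kk μ⌋₊ ⌈rr μ⌉₊ +
    ENNReal.ofReal ((1 - fracα μ) * fracδ μ) * codeCost ⌈kk μ⌉₊ ⌊rr μ⌋₊ +
    ENNReal.ofReal ((1 - fracα μ) * (1 - fracδ μ)) * codeCost ⌈kk μ⌉₊ ⌈rr μ⌉₊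

/-- `C = min {C₁, C₂}` -/
def minCost : ℝ≥0∞ := min (cost₁ μ) (cost₂ μ)

end Parameters

end PRUW

end

/-!
The scheme is built from Shamir sharing. A polynomial of degree at most `|ι|` with prescribed
values at the points of `ι`, plus a random multiple of the polynomial vanishing there (`share`),
has a uniform value at every other point, whatever the prescribed values are. A block is an array
of `K × y` parameters of each submodel, every one with its own point `f j l`, and every database
has its point `α n`. The databases keep, for each row `l`, the values at `α n` of a polynomial of
degree at most `K + y` that takes the values of the parameters at the points of the row.
Queries are shares of unit vectors.

* Reading: the queries for column `j` share, for each row `l`, the unit vector of `l` on the points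
  of the column, with degree at most `y`. The inner product with the contents is the value of a
  polynomial of degree at most `K + 2 y` that takes the required parameters as values at the points
  of the column; `K + 2 y + 1` answers determine it (`exists_answer_poly`).
* Writing: a single symbol shares all updates of column `j`, with degree at most `y`. Its product
  with a query that shares the unit vector of `j` on the points of row `l` has degree at most
  `K + y` and the right values at the points of the row, so adding it to the contents preserves the
  form of the contents (`represents_write`).

A block kept by `R` databases thus costs `K (K + 2 y + 1)` downloads and `K R` uploads for `K y`
parameters, and with `y = ⌊(R - K - 1) / 2⌋` this is the cost `C_T(K, R)`. Privacy and uniformity of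
the contents hold because everything that one database sees is masked by independent random
symbols: a change of the data can be undone by a translation of these
(`Scheme.Certificate.exists_shift`).

To use heterogeneous databases, the storage is divided into slots. Database `n` takes `c n`
consecutive tokens of an enumeration, and token `p` goes into slot `p` modulo the number of slots;
this gives each slot to `ρ` or `ρ + 1` databases, as soon as no `c n` exceeds the number of slots
(`exists_allocation`). Since only the loads matter, the code rates `1 / K` and `1 / (K + 1)` can be
distributed over the slots at will, and the achievable costs are those of the `Weights`: two linear
equations (the model is stored completely, and the capacities are used up) and the inequality
`μ n ≤ ∑ w`. Rational weights are realized exactly by clearing denominators, real ones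
approximately by rounding. What remains is to check that the weights of `C₁`, and those of `C₂` when
`k` is not an integer, satisfy these conditions (`weights_cost₁`, `fractions_feasible`).
-/

noncomputable section

namespace PRUW

/-! ### Entropy -/

section EntropyLemmas

variable {Ω α β : Type} [Fintype α] [Fintype β]

theorem sum_toReal_pmf (ν : PMF α) : ∑ a, (ν a).toReal = 1 := by
  rw [← ENNReal.toReal_sum (fun a _ => ν.apply_ne_top a), ← tsum_fintype (L := .unconditional _),
    ν.tsum_coe, ENNReal.toReal_one]

theorem mutualInfo_eq_zero_of_indep (q : ℕ) (P : PMF Ω) (X : Ω → α) (Y : Ω → β)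
    (h : ∀ a b, P.map (fun ω => (X ω, Y ω)) (a, b) = P.map X a * P.map Y b) :
    mutualInfo q P X Y = 0 := by
  have key : ∑ c : α × β, Real.negMulLog ((P.map (fun ω => (X ω, Y ω))) c).toReal =
      ∑ a, Real.negMulLog ((P.map X) a).toReal + ∑ b, Real.negMulLog ((P.map Y) b).toReal := by
    simp only [Fintype.sum_prod_type, h, ENNReal.toReal_mul, Real.negMulLog_mul,
      Finset.sum_add_distrib, ← Finset.sum_mul, ← Finset.mul_sum, sum_toReal_pmf, one_mul]
  simp only [mutualInfo, entropy, key]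
  ring

theorem entropy_comp_injective (q : ℕ) (P : PMF Ω) (Y : Ω → β) (φ : β → α)
    (hφ : Function.Injective φ) : entropy q P (fun ω => φ (Y ω)) = entropy q P Y := by
  classical
  have hmap : P.map (fun ω => φ (Y ω)) = (P.map Y).map φ := by
    rw [PMF.map_comp]; rfl
  unfold entropy
  rw [hmap]
  congr 1
  refine (Fintype.sum_of_injective φ hφ _ _ (fun a ha => ?_) (fun b => ?_)).symm
  · have : (P.map Y).map φ a = 0 := by
      rw [PMF.apply_eq_zero_iff, PMF.mem_support_map_iff]
      rintro ⟨b, -, rfl⟩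
      exact ha ⟨b, rfl⟩
    simp [this]
  · congr 2
    generalize P.map Y = ν
    rw [PMF.map_apply, tsum_eq_single b]
    · simp
    · intro b' hb'
      simp [hφ.ne hb'.symm]

theorem condEntropy_eq_zero_of_determined (q : ℕ) (P : PMF Ω) (X : Ω → α) (Y : Ω → β)
    (h : ∀ ω ω', Y ω = Y ω' → X ω = X ω') : condEntropy q P X Y = 0 := by
  obtain ⟨ω₀, -⟩ := P.support_nonempty
  have : Nonempty α := ⟨X ω₀⟩
  obtain ⟨g, rfl⟩ := (Function.factorsThrough_iff (f := Y) X).1 (fun ω ω' => h ω ω')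
  have := entropy_comp_injective q P Y (fun b => (g b, b)) (fun b b' hb => (Prod.ext_iff.1 hb).2)
  simp [condEntropy, ← this]

/-- If the law of `V` given the data `i` does not depend on `i`, then `V` is independent of
every function of the data. -/
theorem mutualInfo_bind_eq_zero {I Z : Type} (q : ℕ) (D : PMF I) (U : PMF Z) (X : I → α)
    (V : I × Z → β) (h : ∀ i i', U.map (fun z => V (i, z)) = U.map (fun z => V (i', z))) :
    mutualInfo q (D.bind fun i => U.map fun z => (i, z)) (fun ω => X ω.1) V = 0 := by
  classical
  obtain ⟨i₀, -⟩ := D.support_nonempty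
  set ν := U.map (fun z => V (i₀, z)) with hν
  have hV : (D.bind fun i => U.map fun z => (i, z)).map V = ν := by
    rw [PMF.map_bind]
    simp only [PMF.map_comp]
    have : ∀ i, U.map (V ∘ fun z => (i, z)) = ν := fun i => h i i₀
    simp [this]
  have hX : (D.bind fun i => U.map fun z => (i, z)).map (fun ω => X ω.1) = D.map X := by
    rw [PMF.map_bind]
    simp only [PMF.map_comp]
    have : ∀ i, U.map ((fun ω : I × Z => X ω.1) ∘ fun z => (i, z)) = PMF.pure (X i) :=
      fun i => PMF.map_const U (X i)
    simp only [this]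
    rfl
  refine mutualInfo_eq_zero_of_indep _ _ _ _ fun a b => ?_
  rw [hV, hX, PMF.map_bind]
  simp only [PMF.map_comp]
  have : ∀ i, U.map ((fun ω : I × Z => (X ω.1, V ω)) ∘ fun z => (i, z)) =
      ν.map (fun b => (X i, b)) := by
    intro i
    rw [hν, ← h i i₀, PMF.map_comp]
    rfl
  simp only [this]
  rw [PMF.bind_apply, PMF.map_apply, ← ENNReal.tsum_mul_right]
  refine tsum_congr fun i => ?_
  have h1 : (ν.map (fun b => (X i, b))) (a, b) = if a = X i then ν b else 0 := by
    rw [PMF.map_apply, tsum_eq_single b]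
    · simp
    · intro b' hb'
      simp [hb'.symm]
  rw [h1]
  split_ifs <;> simp

theorem map_uniformOfFintype_equiv {Z Z' : Type} [Fintype Z] [Nonempty Z] [Fintype Z']
    [Nonempty Z'] (e : Z ≃ Z') :
    (PMF.uniformOfFintype Z).map e = PMF.uniformOfFintype Z' := by
  classical
  ext z
  rw [PMF.map_apply, tsum_eq_single (e.symm z)]
  · simp [Fintype.card_congr e]
  · intro b hb
    rw [if_neg]
    rintro rfl
    simp at hb

/-- A random vector whose law is invariant under all translations is uniform, so its entropy,
in units of `log |F|`, is its length. -/
theorem entropy_eq_of_map_add {F : Type} [Field F] [Fintype F] {l : ℕ} (P : PMF Ω)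
    (X : Ω → Fin l → F) (h : ∀ v, (P.map X).map (· + v) = P.map X) :
    entropy (Fintype.card F) P X = l := by
  classical
  have hq : (1 : ℝ) < Fintype.card F := by exact_mod_cast Fintype.one_lt_card
  have hlog : Real.log (Fintype.card F) ≠ 0 := (Real.log_pos hq).ne'
  have hconst : ∀ a, (P.map X) a = (P.map X) 0 := by
    intro a
    conv_lhs => rw [← h a]
    rw [PMF.map_apply, tsum_eq_single 0]
    · simp
    · intro b hb
      simp [hb]
  have hsum := sum_toReal_pmf (P.map X)
  simp only [hconst, Finset.sum_const, Finset.card_univ, Fintype.card_pi, Finset.prod_const,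
    Fintype.card_fin, nsmul_eq_mul, Nat.cast_pow] at hsum
  have hval : ((P.map X) 0).toReal = ((Fintype.card F : ℝ) ^ l)⁻¹ := eq_inv_of_mul_eq_one_right hsum
  unfold entropy
  simp only [hconst, Finset.sum_const, Finset.card_univ, Fintype.card_pi, Finset.prod_const,
    Fintype.card_fin, nsmul_eq_mul, Nat.cast_pow, hval, Real.negMulLog, Real.log_inv, Real.log_pow]
  have : (Fintype.card F : ℝ) ^ l ≠ 0 := by positivity
  field_simp

end EntropyLemmas

/-! ### A criterion for the requirements -/

namespace Scheme

variable {F : Type} [Field F] {N M L : ℕ}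

/-- The deterministic properties of a scheme from which all the requirements follow.
`Valid w s` says that the contents `s` of the databases represent the model `w`. Privacy is
expressed by translations: a change of the data seen by one database (and, for the storage, any
translation `v` of its contents) is the effect of a translation of the random symbols. -/
structure Certificate (P : Scheme F N M L)
    (Valid : Model F M L → (∀ n, Fin (P.storeLen n) → F) → Prop) : Prop where
  encode_shift : ∀ n w w' v, ∃ d, ∀ z, P.encode w' (z + d) n = P.encode w z n + v
  user_shift : ∀ n θ θ' Δ Δ', ∃ d, ∀ z, P.query θ' (z + d) n = P.query θ z n ∧
    P.upload θ' Δ' (z + d) n = P.upload θ Δ z n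
  write_add : ∀ n s v Q U, P.write n (s + v) Q U = P.write n s Q U + v
  valid_encode : ∀ w z, Valid w (P.encode w z)
  valid_write : ∀ w s θ Δ z, Valid w s →
    Valid (fun m => if m = θ then w m + Δ else w m)
      (fun n => P.write n (s n) (P.query θ z n) (P.upload θ Δ z n))
  read : ∀ w s θ z w' s' θ' z', Valid w s → Valid w' s' →
    (∀ n, P.answer n (s n) (P.query θ z n) = P.answer n (s' n) (P.query θ' z' n)) →
    w θ = w' θ'
  valid_unique : ∀ w w' s, Valid w s → Valid w' s → w = w'

namespace Certificate

variable {P : Scheme F N M L} {Valid : Model F M L → (∀ n, Fin (P.storeLen n) → F) → Prop}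
  (h : P.Certificate Valid)
include h

theorem valid_storeAt {T : ℕ} (ω : P.Outcome T) (t : ℕ) :
    Valid (modelAt ω.1 t) (fun n => P.storeAt ω n t) := by
  induction t with
  | zero => exact h.valid_encode _ _
  | succ t ih =>
    by_cases ht : t < T
    · have := h.valid_write _ _ (ω.1.2.1 ⟨t, ht⟩) (ω.1.2.2 ⟨t, ht⟩) (ω.2.2 ⟨t, ht⟩) ih
      simpa [modelAt, storeAt, ht, queryAt, uploadAt] using this
    · simpa [modelAt, storeAt, ht] using ih

/-- Translating all the random symbols suitably changes the data from `i` to `i'` without any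
effect on the queries and uploads of database `n`, and translates its contents by `v`. -/
theorem exists_shift {T : ℕ} (n : Fin N) (i i' : Inputs F M L T) (v : Fin (P.storeLen n) → F) :
    ∃ d : (Fin P.storeNoiseLen → F) × (Fin T → Fin P.userNoiseLen → F), ∀ z,
      (∀ t, P.queryAt (i', z + d) t n = P.queryAt (i, z) t n) ∧
      (∀ t, P.uploadAt (i', z + d) t n = P.uploadAt (i, z) t n) ∧
      ∀ t, P.storeAt (i', z + d) n t = P.storeAt (i, z) n t + v := by
  obtain ⟨d₀, hd₀⟩ := h.encode_shift n i.1 i'.1 v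
  choose d₁ hd₁ using fun t : Fin T => h.user_shift n (i.2.1 t) (i'.2.1 t) (i.2.2 t) (i'.2.2 t)
  refine ⟨(d₀, d₁), fun z => ?_⟩
  have hq : ∀ t, P.queryAt (i', z + (d₀, d₁)) t n = P.queryAt (i, z) t n :=
    fun t => (hd₁ t (z.2 t)).1
  have hu : ∀ t, P.uploadAt (i', z + (d₀, d₁)) t n = P.uploadAt (i, z) t n :=
    fun t => (hd₁ t (z.2 t)).2
  refine ⟨hq, hu, fun t => ?_⟩
  induction t with
  | zero => exact hd₀ z.1
  | succ t ih =>
    by_cases ht : t < T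
    · simp only [storeAt, ht, dif_pos, hq, hu, ih, h.write_add]
    · simp only [storeAt, ht, dif_neg, not_false_eq_true, ih]

variable [Fintype F]

theorem mutualInfo_view {α : Type} [Fintype α] {T : ℕ} (D : PMF (Inputs F M L T)) (n : Fin N)
    (X : Inputs F M L T → α) :
    mutualInfo (Fintype.card F) (P.law D) (fun ω => X ω.1) (P.view n) = 0 := by
  refine mutualInfo_bind_eq_zero _ D _ X (P.view n) fun i i' => ?_
  obtain ⟨d, hd⟩ := h.exists_shift n i i' 0
  conv_rhs => rw [← map_uniformOfFintype_equiv (Equiv.addRight d), PMF.map_comp]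
  congr 1
  funext z
  obtain ⟨hq, hu, hs⟩ := hd z
  simp only [view, Function.comp_apply, Equiv.coe_addRight, hq, hu, hs, add_zero]

theorem isPRUW : P.IsPRUW where
  index_private _ D n := h.mutualInfo_view D n fun i => i.2.1
  update_private _ D n := h.mutualInfo_view D n fun i => i.2.2
  model_secure T D n := h.mutualInfo_view D n fun i => fun t : Fin (T + 1) => modelAt i (t : ℕ)
  read_correct _ _ t := condEntropy_eq_zero_of_determined _ _ _ _ fun ω ω' hω =>
    h.read _ _ _ _ _ _ _ _ (h.valid_storeAt ω t) (h.valid_storeAt ω' t)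
      (congr_fun (Prod.ext_iff.1 hω).2)
  write_correct _ _ t := condEntropy_eq_zero_of_determined _ _ _ _ fun ω ω' hω =>
    h.valid_unique _ _ _ (h.valid_storeAt ω t) (by
      have := h.valid_storeAt ω' t
      rwa [← show (fun n => P.storeAt ω n (t : ℕ)) = fun n => P.storeAt ω' n (t : ℕ) from hω]
        at this)

theorem isFull : P.IsFull := by
  intro T D t n
  refine entropy_eq_of_map_add _ _ fun v => ?_
  simp only [law, PMF.map_bind, PMF.map_comp]
  congr 1
  funext i
  obtain ⟨d, hd⟩ := h.exists_shift n i i v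
  conv_rhs => rw [← map_uniformOfFintype_equiv (Equiv.addRight d), PMF.map_comp]
  congr 1
  funext z
  simp [(hd z).2.2]

end Certificate
end Scheme

/-! ### Polynomial sharing -/

section Share

open Polynomial

variable {F : Type} [Field F] {ι : Type} [Fintype ι] [DecidableEq ι]

/-- The polynomial of degree at most `|ι|` that takes the values `a i` at the points `v i`,
masked by the multiple `z` of the polynomial that vanishes at these points. -/
def share (v : ι → F) (a : ι → F) (z : F) : F[X] :=
  Lagrange.interpolate Finset.univ v a + C z * Lagrange.nodal Finset.univ v

theorem natDegree_share_le {v : ι → F} (hv : Function.Injective v) (a : ι → F) (z : F) :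
    (share v a z).natDegree ≤ Fintype.card ι := by
  refine natDegree_add_le_of_degree_le ?_ ?_
  · exact natDegree_le_of_degree_le (Lagrange.degree_interpolate_lt a hv.injOn).le
  · refine (natDegree_C_mul_le _ _).trans ?_
    rw [Lagrange.natDegree_nodal, Finset.card_univ]

theorem eval_share_node {v : ι → F} (hv : Function.Injective v) (a : ι → F) (z : F) (i : ι) :
    (share v a z).eval (v i) = a i := by
  rw [share, eval_add, Lagrange.eval_interpolate_at_node a hv.injOn (Finset.mem_univ i),
    eval_mul, Lagrange.eval_nodal_at_node (Finset.mem_univ i)]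
  simp

/-- Away from the nodes, the value of `share v a z` is uniform in `z`, whatever `a` is. -/
theorem exists_share_shift {v : ι → F} {x : F} (hx : ∀ i, x ≠ v i) (a a' : ι → F) (c : F) :
    ∃ d, ∀ z, (share v a' (z + d)).eval x = (share v a z).eval x + c := by
  have h0 : (Lagrange.nodal Finset.univ v).eval x ≠ 0 := by
    rw [Lagrange.eval_nodal]
    exact Finset.prod_ne_zero_iff.2 fun i _ => sub_ne_zero.2 (hx i)
  refine ⟨((Lagrange.interpolate Finset.univ v a).eval x -
    (Lagrange.interpolate Finset.univ v a').eval x + c) /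
      (Lagrange.nodal Finset.univ v).eval x, fun z => ?_⟩
  simp only [share, eval_add, eval_mul, eval_C]
  field_simp
  ring

end Share

/-! ### The scheme -/

/-- A division of the model into blocks. Block `i` consists of `K i * y i` parameters of each
submodel; it is stored in the databases of `S i`, each of which keeps `y i` symbols for each
submodel (so that the block is coded with rate `1 / K i`), and it is read from the databases
of `S' i`. -/
structure BlockDesign (N : ℕ) where
  /-- the blocks -/
  I : Type
  [fintypeI : Fintype I]
  /-- the number of parameters combined in a stored symbol -/
  K : I → ℕ
  /-- the number of parameters served by a downloaded or uploaded symbol -/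
  y : I → ℕ
  /-- the databases that store a block -/
  S : I → Finset (Fin N)
  /-- the databases from which a block is read -/
  S' : I → Finset (Fin N)
  S'_subset : ∀ i, S' i ⊆ S i
  card_S' : ∀ i, K i + 2 * y i + 1 ≤ (S' i).card

namespace BlockDesign

attribute [instance] fintypeI

variable {N : ℕ} (B : BlockDesign N) (M : ℕ)

/-- Positions of parameters in a submodel. -/
abbrev Param : Type := Σ i, Fin (B.K i) × Fin (B.y i)

/-- Rows of the stored blocks. -/
abbrev Row : Type := Σ i, Fin (B.y i)

/-- Columns of the stored blocks. -/
abbrev Col : Type := Σ i, Fin (B.K i)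

/-- Positions of symbols in database `n`. -/
abbrev StoreIdx (n : Fin N) : Type := {ρ : B.Row // n ∈ B.S ρ.1} × Fin M

/-- Positions of symbols in a query: `inl` for reading, `inr` for writing. -/
abbrev QueryIdx : Type := (B.Param × Fin M) ⊕ (B.Param × Fin M)

/-- Positions of symbols in the answer of database `n`. -/
abbrev AnsIdx (n : Fin N) : Type := {κ : B.Col // n ∈ B.S' κ.1}

/-- Positions of symbols in an upload to database `n`. -/
abbrev UpdIdx (n : Fin N) : Type := {κ : B.Col // n ∈ B.S κ.1}

/-- Positions of the random symbols of a user. -/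
abbrev UserNoiseIdx : Type := B.QueryIdx M ⊕ B.Col

/-- Distinct points of `F`: one for each database and one for each parameter of a block. -/
structure Points (F : Type) where
  /-- the point of a database -/
  α : Fin N → F
  /-- the point of a parameter -/
  f : ∀ i, Fin (B.K i) → Fin (B.y i) → F
  α_inj : Function.Injective α
  f_inj : ∀ i, Function.Injective fun p : Fin (B.K i) × Fin (B.y i) => f i p.1 p.2
  α_ne_f : ∀ n i j l, α n ≠ f i j l

variable {B M} {F : Type}

namespace Points

variable (pt : B.Points F)

theorem col_inj (i : B.I) (l : Fin (B.y i)) : Function.Injective fun j => pt.f i j l :=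
  fun j j' h => (Prod.ext_iff.1 (@pt.f_inj i (j, l) (j', l) h)).1

theorem row_inj (i : B.I) (j : Fin (B.K i)) : Function.Injective fun l => pt.f i j l :=
  fun l l' h => (Prod.ext_iff.1 (@pt.f_inj i (j, l) (j, l') h)).2

variable [Field F]

open Polynomial

/-- Stored polynomial of a row: the parameters of the row, masked. -/
def storePoly (w : B.Param → F) (z : F) (ρ : B.Row) : F[X] :=
  share (fun j => pt.f ρ.1 j ρ.2) (fun j => w ⟨ρ.1, j, ρ.2⟩) z

/-- Query polynomial for reading: it selects, in submodel `θ` and column `p.2.1`, the parameter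
of row `p.2.2`. -/
def readPoly (θ m : Fin M) (z : F) (p : B.Param) : F[X] :=
  share (fun l => pt.f p.1 p.2.1 l) (fun l => if m = θ ∧ l = p.2.2 then 1 else 0) z

/-- Query polynomial for writing: it selects, in submodel `θ` and row `p.2.2`, the parameter of
column `p.2.1`. -/
def writePoly (θ m : Fin M) (z : F) (p : B.Param) : F[X] :=
  share (fun j => pt.f p.1 j p.2.2) (fun j => if m = θ ∧ j = p.2.1 then 1 else 0) z

/-- Upload polynomial of a column: the updates of all its parameters, masked. -/
def updatePoly (Δ : B.Param → F) (z : F) (κ : B.Col) : F[X] :=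
  share (fun l => pt.f κ.1 κ.2 l) (fun l => Δ ⟨κ.1, κ.2, l⟩) z

/-- Initial contents of database `n`. -/
def encodeSym (w : Fin M → B.Param → F) (z : B.Row × Fin M → F) (n : Fin N)
    (a : B.StoreIdx M n) : F :=
  (pt.storePoly (w a.2) (z (a.1.1, a.2)) a.1.1).eval (pt.α n)

/-- Query to database `n`. -/
def querySym (θ : Fin M) (z : B.UserNoiseIdx M → F) (n : Fin N) : B.QueryIdx M → F
  | .inl a => (pt.readPoly θ a.2 (z (.inl (.inl a))) a.1).eval (pt.α n)
  | .inr a => (pt.writePoly θ a.2 (z (.inl (.inr a))) a.1).eval (pt.α n)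

/-- Upload to database `n`. -/
def uploadSym (Δ : B.Param → F) (z : B.UserNoiseIdx M → F) (n : Fin N) (κ : B.UpdIdx n) : F :=
  (pt.updatePoly Δ (z (.inr κ.1)) κ.1).eval (pt.α n)

end Points

variable [Field F]

/-- Answer of database `n`: for each column, the inner product of the stored symbols with the
query. -/
def answerSym (n : Fin N) (s : B.StoreIdx M n → F) (Q : B.QueryIdx M → F) (κ : B.AnsIdx n) : F :=
  ∑ l, ∑ m, s (⟨⟨κ.1.1, l⟩, B.S'_subset _ κ.2⟩, m) * Q (.inl (⟨κ.1.1, κ.1.2, l⟩, m))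

/-- Increment of the contents of database `n`. -/
def writeSym (n : Fin N) (Q : B.QueryIdx M → F) (U : B.UpdIdx n → F) (a : B.StoreIdx M n) : F :=
  ∑ j, U ⟨⟨a.1.1.1, j⟩, a.1.2⟩ * Q (.inr (⟨a.1.1.1, j, a.1.1.2⟩, a.2))

open Polynomial in
/-- The contents `s` of the databases are the values, at the points of the databases, of
polynomials of degree at most `K i + y i` that take the values `w` at the points of the
parameters. -/
def Represents (pt : B.Points F) (w : Fin M → B.Param → F) (s : ∀ n, B.StoreIdx M n → F) : Prop :=
  ∃ p : B.Row → Fin M → F[X], (∀ ρ m, (p ρ m).natDegree ≤ B.K ρ.1 + B.y ρ.1) ∧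
    (∀ ρ m j, (p ρ m).eval (pt.f ρ.1 j ρ.2) = w m ⟨ρ.1, j, ρ.2⟩) ∧
    ∀ n a, s n a = (p a.1.1 a.2).eval (pt.α n)

variable (pt : B.Points F)

theorem represents_encodeSym (w : Fin M → B.Param → F) (z : B.Row × Fin M → F) :
    Represents pt w (fun n => pt.encodeSym w z n) := by
  refine ⟨fun ρ m => pt.storePoly (w m) (z (ρ, m)) ρ, fun ρ m => ?_, fun ρ m j => ?_,
    fun n a => rfl⟩
  · refine (natDegree_share_le (pt.col_inj _ _) _ _).trans ?_
    simp
  · exact eval_share_node (pt.col_inj ρ.1 ρ.2) _ _ j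

/-- The increment polynomial `∑ j, U_j V_j` of a row has degree at most `K i + y i`; at the point
of the parameter in column `j` only its `j`-th term survives, and its value is the update of
this parameter if the row belongs to the submodel `θ`, and `0` otherwise. -/
theorem represents_write {w : Fin M → B.Param → F} {s : ∀ n, B.StoreIdx M n → F}
    (h : Represents pt w s) (θ : Fin M) (Δ : B.Param → F) (z : B.UserNoiseIdx M → F) :
    Represents pt (fun m => if m = θ then w m + Δ else w m)
      (fun n a => s n a + writeSym n (pt.querySym θ z n) (pt.uploadSym Δ z n) a) := by
  obtain ⟨p, hdeg, hval, hs⟩ := h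
  refine ⟨fun ρ m => p ρ m + ∑ j, pt.updatePoly Δ (z (.inr ⟨ρ.1, j⟩)) ⟨ρ.1, j⟩ *
    pt.writePoly θ m (z (.inl (.inr (⟨ρ.1, j, ρ.2⟩, m)))) ⟨ρ.1, j, ρ.2⟩, fun ρ m => ?_,
    fun ρ m j => ?_, fun n a => ?_⟩
  · refine Polynomial.natDegree_add_le_of_degree_le (hdeg ρ m)
      (Polynomial.natDegree_sum_le_of_forall_le _ _ fun j _ => ?_)
    refine (Polynomial.natDegree_mul_le_of_le (natDegree_share_le (pt.row_inj _ _) _ _)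
      (natDegree_share_le (pt.col_inj _ _) _ _)).trans ?_
    simp [add_comm]
  · have hW : ∀ j' : Fin (B.K ρ.1), (pt.writePoly θ m (z (.inl (.inr (⟨ρ.1, j', ρ.2⟩, m))))
        ⟨ρ.1, j', ρ.2⟩).eval (pt.f ρ.1 j ρ.2) = if m = θ ∧ j = j' then 1 else 0 :=
      fun j' => eval_share_node (pt.col_inj ρ.1 ρ.2) _ _ j
    have hU : (pt.updatePoly Δ (z (.inr ⟨ρ.1, j⟩)) ⟨ρ.1, j⟩).eval (pt.f ρ.1 j ρ.2) =
        Δ ⟨ρ.1, j, ρ.2⟩ := eval_share_node (pt.row_inj ρ.1 j) _ _ ρ.2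
    simp only [Polynomial.eval_add, Polynomial.eval_finsetSum, Polynomial.eval_mul, hval, hW]
    by_cases hm : m = θ
    · simp [hm, hU]
    · simp [hm]
  · simp only [hs, Polynomial.eval_add, Polynomial.eval_finsetSum, Polynomial.eval_mul]
    rfl

/-- The answers for a column are values of a polynomial of degree at most `K i + 2 * y i`, whose
values at the points of the column are the required parameters. -/
theorem exists_answer_poly {w : Fin M → B.Param → F} {s : ∀ n, B.StoreIdx M n → F}
    (h : Represents pt w s) (θ : Fin M) (z : B.UserNoiseIdx M → F) (κ : B.Col) :
    ∃ g : Polynomial F, g.natDegree ≤ B.K κ.1 + 2 * B.y κ.1 ∧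
      (∀ l, g.eval (pt.f κ.1 κ.2 l) = w θ ⟨κ.1, κ.2, l⟩) ∧
      ∀ n (hn : n ∈ B.S' κ.1),
        answerSym n (s n) (pt.querySym θ z n) ⟨κ, hn⟩ = g.eval (pt.α n) := by
  obtain ⟨p, hdeg, hval, hs⟩ := h
  refine ⟨∑ l, ∑ m, p ⟨κ.1, l⟩ m *
    pt.readPoly θ m (z (.inl (.inl (⟨κ.1, κ.2, l⟩, m)))) ⟨κ.1, κ.2, l⟩, ?_, fun l => ?_,
    fun n hn => ?_⟩
  · refine Polynomial.natDegree_sum_le_of_forall_le _ _ fun l _ =>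
      Polynomial.natDegree_sum_le_of_forall_le _ _ fun m _ => ?_
    refine (Polynomial.natDegree_mul_le_of_le (hdeg _ _)
      (natDegree_share_le (pt.row_inj _ _) _ _)).trans ?_
    simp only [Fintype.card_fin]
    omega
  · have hR : ∀ l' m, (pt.readPoly θ m (z (.inl (.inl (⟨κ.1, κ.2, l'⟩, m))))
        ⟨κ.1, κ.2, l'⟩).eval (pt.f κ.1 κ.2 l) = if m = θ ∧ l = l' then 1 else 0 :=
      fun l' m => eval_share_node (pt.row_inj κ.1 κ.2) _ _ l
    simp only [Polynomial.eval_finsetSum, Polynomial.eval_mul, hR, ite_and]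
    have := hval ⟨κ.1, l⟩ θ κ.2
    simp [this]
  · simp only [answerSym, Polynomial.eval_finsetSum, Polynomial.eval_mul, hs]
    rfl

open Polynomial in
theorem eq_of_eval_points_eq {S : Finset (Fin N)} {g g' : F[X]} {d : ℕ} (hg : g.natDegree ≤ d)
    (hg' : g'.natDegree ≤ d) (hS : d < S.card)
    (h : ∀ n ∈ S, g.eval (pt.α n) = g'.eval (pt.α n)) : g = g' := by
  classical
  have hc : (S.map ⟨pt.α, pt.α_inj⟩).card = S.card := Finset.card_map _
  refine Polynomial.eq_of_degrees_lt_of_eval_finset_eq (S.map ⟨pt.α, pt.α_inj⟩) ?_ ?_ ?_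
  · rw [hc]
    exact (degree_le_of_natDegree_le hg).trans_lt (by exact_mod_cast hS)
  · rw [hc]
    exact (degree_le_of_natDegree_le hg').trans_lt (by exact_mod_cast hS)
  · intro x hx
    obtain ⟨n, hn, rfl⟩ := Finset.mem_map.1 hx
    exact h n hn

theorem eq_of_answers_eq {w w' : Fin M → B.Param → F} {s s' : ∀ n, B.StoreIdx M n → F}
    (h : Represents pt w s) (h' : Represents pt w' s') (θ θ' : Fin M)
    (z z' : B.UserNoiseIdx M → F)
    (heq : ∀ n, answerSym n (s n) (pt.querySym θ z n) = answerSym n (s' n) (pt.querySym θ' z' n)) :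
    w θ = w' θ' := by
  funext ⟨i, j, l⟩
  obtain ⟨g, hg, hval, hans⟩ := exists_answer_poly pt h θ z ⟨i, j⟩
  obtain ⟨g', hg', hval', hans'⟩ := exists_answer_poly pt h' θ' z' ⟨i, j⟩
  have : g = g' := eq_of_eval_points_eq pt hg hg' (B.card_S' i) fun n hn => by
    rw [← hans n hn, ← hans' n hn, heq]
  rw [← hval l, ← hval' l, this]

theorem Represents.unique {w w' : Fin M → B.Param → F} {s : ∀ n, B.StoreIdx M n → F}
    (h : Represents pt w s) (h' : Represents pt w' s) : w = w' := by
  obtain ⟨p, hdeg, hval, hs⟩ := h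
  obtain ⟨p', hdeg', hval', hs'⟩ := h'
  funext m ⟨i, j, l⟩
  have hc := B.card_S' i
  have : p ⟨i, l⟩ m = p' ⟨i, l⟩ m :=
    eq_of_eval_points_eq pt (hdeg _ m) (hdeg' _ m) (S := B.S' i) (by simp only; omega)
      fun n hn => by
        rw [← hs n (⟨⟨i, l⟩, B.S'_subset i hn⟩, m), ← hs' n (⟨⟨i, l⟩, B.S'_subset i hn⟩, m)]
  rw [← hval ⟨i, l⟩ m j, ← hval' ⟨i, l⟩ m j, this]

theorem exists_encodeSym_shift (n : Fin N) (w w' : Fin M → B.Param → F)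
    (v : B.StoreIdx M n → F) :
    ∃ d, ∀ z, pt.encodeSym w' (z + d) n = pt.encodeSym w z n + v := by
  classical
  choose d hd using fun a : B.Row × Fin M =>
    exists_share_shift (v := fun j => pt.f a.1.1 j a.1.2) (x := pt.α n)
      (fun j => pt.α_ne_f n _ j _) (fun j => w a.2 ⟨a.1.1, j, a.1.2⟩)
      (fun j => w' a.2 ⟨a.1.1, j, a.1.2⟩)
      (if h : n ∈ B.S a.1.1 then v (⟨a.1, h⟩, a.2) else 0)
  refine ⟨d, fun z => ?_⟩
  funext ⟨⟨ρ, hρ⟩, m⟩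
  have := hd (ρ, m) (z (ρ, m))
  simp only [hρ, dif_pos] at this
  exact this

theorem exists_userSym_shift (n : Fin N) (θ θ' : Fin M) (Δ Δ' : B.Param → F) :
    ∃ d, ∀ z, pt.querySym θ' (z + d) n = pt.querySym θ z n ∧
      pt.uploadSym Δ' (z + d) n = pt.uploadSym Δ z n := by
  choose d₁ h₁ using fun a : B.Param × Fin M =>
    exists_share_shift (v := fun l => pt.f a.1.1 a.1.2.1 l) (x := pt.α n)
      (fun l => pt.α_ne_f n _ _ l) (fun l => if a.2 = θ ∧ l = a.1.2.2 then 1 else 0)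
      (fun l => if a.2 = θ' ∧ l = a.1.2.2 then 1 else 0) 0
  choose d₂ h₂ using fun a : B.Param × Fin M =>
    exists_share_shift (v := fun j => pt.f a.1.1 j a.1.2.2) (x := pt.α n)
      (fun j => pt.α_ne_f n _ j _) (fun j => if a.2 = θ ∧ j = a.1.2.1 then 1 else 0)
      (fun j => if a.2 = θ' ∧ j = a.1.2.1 then 1 else 0) 0
  choose d₃ h₃ using fun κ : B.Col =>
    exists_share_shift (v := fun l => pt.f κ.1 κ.2 l) (x := pt.α n)
      (fun l => pt.α_ne_f n _ _ l) (fun l => Δ ⟨κ.1, κ.2, l⟩) (fun l => Δ' ⟨κ.1, κ.2, l⟩) 0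
  refine ⟨Sum.elim (Sum.elim d₁ d₂) d₃, fun z => ⟨?_, ?_⟩⟩
  · funext a
    rcases a with a | a
    · exact (h₁ a (z (.inl (.inl a)))).trans (add_zero _)
    · exact (h₂ a (z (.inl (.inr a)))).trans (add_zero _)
  · funext κ
    exact (h₃ κ.1 (z (.inr κ.1))).trans (add_zero _)

/-! ### Translation to lists of symbols -/

variable {L : ℕ} (e : Fin L ≃ B.Param)

/-- Vectors with entries indexed by positions, as lists of symbols in an arbitrary order. -/
def reindex {ι : Type} [Fintype ι] : (Fin (Fintype.card ι) → F) ≃+ (ι → F) where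
  toEquiv := (Equiv.arrowCongr (Fintype.equivFin ι) (Equiv.refl F)).symm
  map_add' _ _ := rfl

theorem reindex_shift {ι ι' : Type} [Fintype ι] [Fintype ι'] {φ ψ : (ι → F) → ι' → F}
    (d : ι → F) (h : ∀ z, φ (z + d) = ψ z) (z : Fin (Fintype.card ι) → F) :
    reindex.symm (φ (reindex (z + reindex.symm d))) = reindex.symm (ψ (reindex z)) := by
  rw [map_add, AddEquiv.apply_symm_apply, h]

theorem reindex_shift_add {ι ι' : Type} [Fintype ι] [Fintype ι'] {φ ψ : (ι → F) → ι' → F}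
    (d : ι → F) (v : Fin (Fintype.card ι') → F) (h : ∀ z, φ (z + d) = ψ z + reindex v)
    (z : Fin (Fintype.card ι) → F) :
    reindex.symm (φ (reindex (z + reindex.symm d))) = reindex.symm (ψ (reindex z)) + v := by
  rw [map_add, AddEquiv.apply_symm_apply, h, map_add, AddEquiv.symm_apply_apply]

/-- The scheme of a block design, for submodels whose parameters are numbered by `e`. -/
def toScheme (M : ℕ) : Scheme F N M L where
  storeLen n := Fintype.card (B.StoreIdx M n)
  queryLen _ := Fintype.card (B.QueryIdx M)
  ansLen n := Fintype.card (B.AnsIdx n)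
  updLen n := Fintype.card (B.UpdIdx n)
  storeNoiseLen := Fintype.card (B.Row × Fin M)
  userNoiseLen := Fintype.card (B.UserNoiseIdx M)
  encode w z n := reindex.symm (pt.encodeSym (fun m => w m ∘ e.symm) (reindex z) n)
  query θ z n := reindex.symm (pt.querySym θ (reindex z) n)
  answer n s Q := reindex.symm (answerSym n (reindex s) (reindex Q))
  upload _ Δ z n := reindex.symm (pt.uploadSym (Δ ∘ e.symm) (reindex (ι := B.UserNoiseIdx M) z) n)
  write n s Q U := s + reindex.symm (writeSym n (reindex Q) (reindex U))

theorem toScheme_certificate (M : ℕ) :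
    (toScheme pt e M).Certificate fun w s =>
      Represents pt (fun m => w m ∘ e.symm) (fun n => reindex (s n)) where
  encode_shift n w w' v := by
    obtain ⟨d, hd⟩ := exists_encodeSym_shift pt n (fun m => w m ∘ e.symm)
      (fun m => w' m ∘ e.symm) (reindex v)
    refine ⟨reindex.symm d, fun z => ?_⟩
    exact reindex_shift_add (φ := fun z => pt.encodeSym (fun m => w' m ∘ e.symm) z n)
      (ψ := fun z => pt.encodeSym (fun m => w m ∘ e.symm) z n) d v hd z
  user_shift n θ θ' Δ Δ' := by
    obtain ⟨d, hd⟩ := exists_userSym_shift (M := M) pt n θ θ' (Δ ∘ e.symm) (Δ' ∘ e.symm)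
    refine ⟨reindex.symm d, fun z => ?_⟩
    exact ⟨reindex_shift (φ := fun z => pt.querySym θ' z n) (ψ := fun z => pt.querySym θ z n) d
      (fun z => (hd z).1) z,
      reindex_shift (φ := fun z => pt.uploadSym (M := M) (Δ' ∘ e.symm) z n)
        (ψ := fun z => pt.uploadSym (M := M) (Δ ∘ e.symm) z n) d (fun z => (hd z).2) z⟩
  write_add n s v Q U := by
    simp only [toScheme]
    abel
  valid_encode w z := by
    simp only [toScheme, AddEquiv.apply_symm_apply]
    exact represents_encodeSym pt _ (reindex z)
  valid_write w s θ Δ z h := by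
    have := represents_write pt h θ (Δ ∘ e.symm) (reindex z)
    simp only [toScheme, AddEquiv.apply_symm_apply]
    convert this using 2 with m n
    · split_ifs <;> rfl
    · exact (map_add reindex _ _).trans (by rw [AddEquiv.apply_symm_apply]; rfl)
  read w s θ z w' s' θ' z' h h' heq := by
    have := eq_of_answers_eq pt h h' θ θ' (reindex z) (reindex z') fun n => by
      have := heq n
      simpa only [toScheme, AddEquiv.apply_symm_apply, EmbeddingLike.apply_eq_iff_eq] using this
    exact e.symm.surjective.injective_comp_right this
  valid_unique w w' s h h' := by
    have := Represents.unique pt h h'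
    funext m
    exact e.symm.surjective.injective_comp_right (congr_fun this m)

theorem card_storeIdx (n : Fin N) :
    Fintype.card (B.StoreIdx M n) = (∑ i with n ∈ B.S i, B.y i) * M := by
  classical
  rw [Fintype.card_prod, Fintype.card_fin, Fintype.card_subtype]
  congr 1
  rw [Finset.card_filter, Fintype.sum_sigma, Finset.sum_filter]
  refine Finset.sum_congr rfl fun i _ => ?_
  by_cases h : n ∈ B.S i <;> simp [h]

theorem sum_card_col (S : B.I → Finset (Fin N)) :
    ∑ n, Fintype.card {κ : B.Col // n ∈ S κ.1} = ∑ i, B.K i * (S i).card := by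
  classical
  simp only [Fintype.card_subtype, Finset.card_filter]
  rw [Finset.sum_comm, Fintype.sum_sigma]
  refine Finset.sum_congr rfl fun i _ => ?_
  simp

theorem totalCost_toScheme : (toScheme pt e M).totalCost =
    (∑ i, (B.K i : ℝ) * ((B.S' i).card + (B.S i).card)) / L := by
  have h1 := sum_card_col B.S'
  have h2 := sum_card_col B.S
  simp only [Scheme.totalCost, Scheme.readCost, Scheme.writeCost, toScheme, ← Nat.cast_sum, ← add_div]
  rw [h1, h2]
  push_cast
  simp only [mul_add, Finset.sum_add_distrib]

end BlockDesign

/-! ### Allocation of storage -/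

/-- The number of tokens `p < P` with `p % D = u`. -/
theorem card_filter_mod_eq {D P d : ℕ} (ρ : ℕ) (hD : d ≤ D) (hP : P = ρ * D + d) {u : ℕ}
    (hu : u < D) :
    ((Finset.range P).filter fun p => p % D = u).card = if u < d then ρ + 1 else ρ := by
  have hD0 : 0 < D := by omega
  have : (Finset.range P).filter (fun p => p % D = u) =
      (Finset.range (if u < d then ρ + 1 else ρ)).image fun j => j * D + u := by
    ext p
    simp only [Finset.mem_filter, Finset.mem_range, Finset.mem_image]
    constructor
    · rintro ⟨hp, rfl⟩
      refine ⟨p / D, ?_, Nat.div_add_mod' p D⟩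
      have h := Nat.div_add_mod' p D
      by_contra hlt
      split_ifs at hlt with hd
      · have : (ρ + 1) * D ≤ p / D * D := Nat.mul_le_mul_right D (by omega)
        rw [add_mul] at this
        omega
      · have : ρ * D ≤ p / D * D := Nat.mul_le_mul_right D (by omega)
        omega
    · rintro ⟨j, hj, rfl⟩
      refine ⟨?_, by rw [Nat.mul_add_mod_self_right, Nat.mod_eq_of_lt hu]⟩
      split_ifs at hj with hd
      · have : j * D ≤ ρ * D := Nat.mul_le_mul_right D (by omega)
        omega
      · have : (j + 1) * D ≤ ρ * D := Nat.mul_le_mul_right D (by omega)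
        rw [add_mul] at this
        omega
  rw [this, Finset.card_image_of_injective _ fun j j' hjj => by
    have : j * D = j' * D := by simpa using hjj
    exact Nat.eq_of_mul_eq_mul_right hD0 this, Finset.card_range]

/-- Wrap-around rule: if database `n` takes `c n ≤ D` consecutive tokens among `0, 1, 2, …`, and
token `p` fills slot `p % D`, then no slot receives two tokens of the same database, and the
loads of the slots differ by at most one. -/
theorem exists_allocation {N D d : ℕ} (ρ : ℕ) (c : Fin N → ℕ) (hc : ∀ n, c n ≤ D) (hd : d ≤ D)
    (hsum : ∑ n, c n = ρ * D + d) :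
    ∃ S : Fin D → Finset (Fin N), (∀ n, (Finset.univ.filter fun u => n ∈ S u).card = c n) ∧
      ∀ u, (S u).card = if (u : ℕ) < d then ρ + 1 else ρ := by
  classical
  -- tokens are pairs `⟨n, i⟩`, numbered by `finSigmaFinEquiv`
  set tok : Fin N → ℕ → ℕ := fun n i => (∑ k : Fin n, c (Fin.castLE n.2.le k)) + i with htok
  have hnum : ∀ x : (Σ n, Fin (c n)), ((finSigmaFinEquiv x : Fin _) : ℕ) = tok x.1 x.2 :=
    fun x => finSigmaFinEquiv_apply x
  -- tokens of one database in one slot coincide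
  have hinj : ∀ n, ∀ i < c n, ∀ j < c n, tok n i % D = tok n j % D → i = j := by
    intro n i hi j hj h
    have h' : i ≡ j [MOD D] := Nat.ModEq.add_left_cancel' _ h
    rw [Nat.ModEq, Nat.mod_eq_of_lt (hi.trans_le (hc n)), Nat.mod_eq_of_lt (hj.trans_le (hc n))]
      at h'
    exact h'
  refine ⟨fun u => Finset.univ.filter fun n => ∃ i : Fin (c n), tok n i % D = u, fun n => ?_,
    fun u => ?_⟩
  · have : (Finset.univ.filter fun u : Fin D => n ∈ (Finset.univ.filter fun n =>
        ∃ i : Fin (c n), tok n i % D = u)) =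
        (Finset.univ : Finset (Fin (c n))).image fun i : Fin (c n) =>
          (⟨tok n i % D, Nat.mod_lt _ (i.pos.trans_le (hc n))⟩ : Fin D) := by
      ext u
      simp [Fin.ext_iff]
    rw [this, Finset.card_image_of_injective, Finset.card_univ, Fintype.card_fin]
    intro i j hij
    exact Fin.ext (hinj n i i.2 j j.2 (Fin.ext_iff.1 hij))
  · rw [← card_filter_mod_eq ρ hd hsum u.2]
    symm
    have h1 : ((Finset.range (∑ n, c n)).filter fun p => p % D = u).card =
        (Finset.univ.filter fun x : (Σ n, Fin (c n)) => tok x.1 x.2 % D = u).card := by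
      symm
      refine Finset.card_bij (fun x _ => ((finSigmaFinEquiv x : Fin _) : ℕ)) ?_ ?_ ?_
      · intro x hx
        simp only [Finset.mem_filter, Finset.mem_univ, true_and] at hx
        simp only [Finset.mem_filter, Finset.mem_range, Fin.is_lt, true_and]
        rw [hnum, hx]
      · intro x _ x' _ h
        exact finSigmaFinEquiv.injective (Fin.ext h)
      · intro p hp
        simp only [Finset.mem_filter, Finset.mem_range] at hp
        refine ⟨finSigmaFinEquiv.symm ⟨p, hp.1⟩, ?_, by simp⟩
        simp only [Finset.mem_filter, Finset.mem_univ, true_and]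
        rw [← hnum]
        simpa using hp.2
    rw [h1]
    refine Finset.card_bij (fun x _ => x.1) ?_ ?_ ?_
    · intro x hx
      simp only [Finset.mem_filter, Finset.mem_univ, true_and] at hx ⊢
      exact ⟨x.2, hx⟩
    · rintro ⟨n, i⟩ hx ⟨n', i'⟩ hx' h
      obtain rfl : n = n' := h
      simp only [Finset.mem_filter, Finset.mem_univ, true_and] at hx hx'
      rw [Fin.ext (hinj n i i.2 i' i'.2 (hx.trans hx'.symm))]
    · intro n hn
      simp only [Finset.mem_filter, Finset.mem_univ, true_and] at hn
      obtain ⟨i, hi⟩ := hn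
      exact ⟨⟨n, i⟩, by simpa using hi, rfl⟩

/-- A load vector `e` can be raised to any larger sum that the bound `D` allows. -/
theorem exists_raise {N D : ℕ} (e : Fin N → ℕ) (he : ∀ n, e n ≤ D) (k : ℕ)
    (hk : ∑ n, e n + k ≤ N * D) :
    ∃ c : Fin N → ℕ, (∀ n, c n ≤ D) ∧ (∀ n, e n ≤ c n) ∧ (∀ n, c n ≤ e n + k) ∧
      ∑ n, c n = ∑ n, e n + k := by
  induction k with
  | zero => exact ⟨e, he, fun n => le_rfl, fun n => le_rfl, rfl⟩
  | succ k ih =>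
    obtain ⟨c, hcD, hec, hce, hsum⟩ := ih (by omega)
    have : ∃ n, c n < D := by
      by_contra! h
      have : ∑ n : Fin N, D ≤ ∑ n, c n := Finset.sum_le_sum fun n _ => h n
      simp at this
      omega
    obtain ⟨n, hn⟩ := this
    refine ⟨Function.update c n (c n + 1), fun m => ?_, fun m => ?_, fun m => ?_, ?_⟩
    · rcases eq_or_ne m n with rfl | h
      · simpa using hn
      · simpa [h] using hcD m
    · have := hec m
      rcases eq_or_ne m n with rfl | h
      · simp; omega
      · simpa [h] using this
    · have := hce m
      rcases eq_or_ne m n with rfl | h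
      · simp; omega
      · simp [h]; omega
    · rw [Finset.sum_update_of_mem (Finset.mem_univ n)]
      have := Finset.add_sum_erase Finset.univ c (Finset.mem_univ n)
      rw [Finset.sdiff_singleton_eq_erase]
      omega


/-! ### Slots -/

theorem codeCost_eq_top {a b : ℕ} (h : b < a + 3) : codeCost a b = ∞ := by
  rw [codeCost, if_neg (by omega), if_neg (by omega)]

theorem codeCost_eq {a b : ℕ} (h : a + 3 ≤ b) :
    codeCost a b = ENNReal.ofReal
      ((((a + 2 * ((b - a - 1) / 2) + 1 : ℕ) : ℝ) + b) / ((b - a - 1) / 2 : ℕ)) := by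
  obtain ⟨c, rfl⟩ : ∃ c, b = a + 3 + c := ⟨b - (a + 3), by omega⟩
  rcases Nat.even_or_odd' c with ⟨d, rfl | rfl⟩
  · have h1 : Odd (a + 3 + 2 * d - a) := ⟨d + 1, by omega⟩
    have h2 : (a + 3 + 2 * d - a - 1) / 2 = d + 1 := by omega
    rw [codeCost, if_pos ⟨h1, by omega⟩, h2]
    congr 1
    push_cast
    rw [div_eq_div_iff (by ring_nf; positivity) (by positivity)]
    ring
  · have h1 : Even (a + 3 + (2 * d + 1) - a) := ⟨d + 2, by omega⟩
    have h2 : (a + 3 + (2 * d + 1) - a - 1) / 2 = d + 1 := by omega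
    rw [codeCost, if_neg (fun h => (Nat.not_odd_iff_even.2 h1) h.1), if_pos ⟨h1, by omega⟩, h2]
    congr 1
    push_cast
    rw [div_eq_div_iff (by ring_nf; positivity) (by positivity)]
    ring

theorem codeCost_ne_top_iff {a b : ℕ} : codeCost a b ≠ ∞ ↔ a + 3 ≤ b := by
  refine ⟨fun h => ?_, fun h => ?_⟩
  · by_contra hlt
    exact h (codeCost_eq_top (by omega))
  · rw [codeCost_eq h]
    exact ENNReal.ofReal_ne_top

/-- Downloads from `a + 2 y + 1` databases and uploads to `b` databases, with
`y = ⌊(b - a - 1) / 2⌋` parameters per symbol. -/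
theorem toReal_codeCost {a b : ℕ} (h : a + 3 ≤ b) :
    (codeCost a b).toReal =
      (((a + 2 * ((b - a - 1) / 2) + 1 : ℕ) : ℝ) + b) / ((b - a - 1) / 2 : ℕ) := by
  rw [codeCost_eq h, ENNReal.toReal_ofReal (by positivity)]

theorem BlockDesign.exists_points {N : ℕ} (B : BlockDesign N) (hK : ∀ i, B.K i ≤ N)
    (hy : ∀ i, B.y i ≤ N) (F : Type) [Fintype F] (hF : N + N * N ≤ Fintype.card F) :
    Nonempty (B.Points F) := by
  obtain ⟨g⟩ : Nonempty ((Fin N ⊕ Fin N × Fin N) ↪ F) :=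
    Function.Embedding.nonempty_of_card_le (by simpa using hF)
  refine ⟨⟨fun n => g (.inl n),
    fun i j l => g (.inr (Fin.castLE (hK i) j, Fin.castLE (hy i) l)), ?_, ?_, ?_⟩⟩
  · exact g.injective.comp Sum.inl_injective
  · rintro i ⟨j, l⟩ ⟨j', l'⟩ h
    simpa using h
  · intro n i j l h
    simp at h

/-- Slot `u` keeps the same number of symbols in each database of `S u`, with code rate
`1 / κ u`. The fraction `κ u / E` of the model is stored in slot `u`. -/
theorem achievesUpTo_of_slots {N : ℕ} {U : Type} [Fintype U] (κ : U → ℕ)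
    (S : U → Finset (Fin N)) (hS : ∀ u, κ u + 3 ≤ (S u).card) {E : ℕ} (hE : 0 < E)
    (hκ : ∑ u, κ u = E) (μ : Fin N → ℝ) (C ε : ℝ)
    (hμ : ∀ n, |((Finset.univ.filter fun u => n ∈ S u).card : ℝ) / E - μ n| ≤ ε)
    (hC : |(∑ u, (κ u : ℝ) * (codeCost (κ u) (S u).card).toReal) / E - C| ≤ ε) :
    AchievesUpTo μ C (N + N * N) ε := by
  classical
  refine ⟨E * N.factorial, Nat.mul_pos hE N.factorial_pos, ?_⟩
  intro M L hM hL hdvd F _ _ hF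
  obtain ⟨t, rfl⟩ := hdvd
  have ht : 0 < t := Nat.pos_of_mul_pos_left hL
  -- each slot holds `h` symbols per database and submodel
  set h := N.factorial * t with hh
  have hh0 : 0 < h := Nat.mul_pos N.factorial_pos ht
  set y : U → ℕ := fun u => ((S u).card - κ u - 1) / 2 with hy
  have hSN : ∀ u, (S u).card ≤ N := fun u => by simpa using (S u).card_le_univ
  have hy0 : ∀ u, 0 < y u := fun u => by
    have := hS u
    simp only [hy]
    omega
  have hyN : ∀ u, y u ≤ N := fun u => by
    have := hS u
    have := hSN u
    simp only [hy]
    omega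
  have hmul : ∀ u, h / y u * y u = h := fun u =>
    Nat.div_mul_cancel ((Nat.dvd_factorial (hy0 u) (hyN u)).mul_right t)
  choose S' hS'S hS' using fun u => Finset.exists_subset_card_eq
    (show κ u + 2 * y u + 1 ≤ (S u).card by
      have := hS u
      simp only [hy]
      omega)
  let B : BlockDesign N :=
    { I := Σ u, Fin (h / y u)
      K := fun i => κ i.1
      y := fun i => y i.1
      S := fun i => S i.1
      S' := fun i => S' i.1
      S'_subset := fun i => hS'S i.1
      card_S' := fun i => (hS' i.1).ge }
  obtain ⟨pt⟩ := B.exists_points (fun i => by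
    have := hS i.1
    have := hSN i.1
    show κ i.1 ≤ N
    omega) (fun i => hyN i.1) F hF
  have hcard : Fintype.card B.Param = E * N.factorial * t := by
    rw [Fintype.card_sigma]
    simp only [Fintype.card_prod, Fintype.card_fin]
    rw [Fintype.sum_sigma]
    simp only [B, Finset.sum_const, Finset.card_univ, Fintype.card_fin, smul_eq_mul]
    have : ∀ u, h / y u * (κ u * y u) = κ u * h := fun u => by
      rw [mul_left_comm, hmul]
    rw [Finset.sum_congr rfl fun u _ => this u, ← Finset.sum_mul, hκ, hh, mul_assoc]
  let e : Fin (E * N.factorial * t) ≃ B.Param := (Fintype.equivFinOfCardEq hcard).symm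
  have hcert := BlockDesign.toScheme_certificate pt e M
  have hLh : ((E * N.factorial * t : ℕ) : ℝ) = E * h := by
    rw [hh, mul_assoc]
    push_cast
    ring
  have hE' : (E : ℝ) ≠ 0 := by exact_mod_cast hE.ne'
  have hh' : (h : ℝ) ≠ 0 := by exact_mod_cast hh0.ne'
  refine ⟨BlockDesign.toScheme pt e M, hcert.isPRUW, hcert.isFull, fun n => ?_, ?_⟩
  · have hlen : (BlockDesign.toScheme pt e M).storeLen n =
        (Finset.univ.filter fun u => n ∈ S u).card * h * M := by
      refine (BlockDesign.card_storeIdx (B := B) (M := M) n).trans ?_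
      congr 1
      rw [Finset.sum_filter, Fintype.sum_sigma, Finset.card_filter, Finset.sum_mul]
      refine Finset.sum_congr rfl fun u _ => ?_
      by_cases hn : n ∈ S u
      · simp [B, hn, hmul]
      · simp [B, hn]
    rw [hlen, hLh]
    have : (((Finset.univ.filter fun u => n ∈ S u).card * h * M : ℕ) : ℝ) - μ n * M * (E * h) =
        (((Finset.univ.filter fun u => n ∈ S u).card : ℝ) / E - μ n) * (M * (E * h)) := by
      push_cast
      field_simp
    rw [this, abs_mul, abs_of_nonneg (by positivity : (0 : ℝ) ≤ M * (E * h)), mul_assoc ε]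
    exact mul_le_mul_of_nonneg_right (hμ n) (by positivity)
  · rw [BlockDesign.totalCost_toScheme, hLh]
    convert hC using 3
    rw [Fintype.sum_sigma, mul_comm (E : ℝ), ← div_div]
    congr 1
    rw [Finset.sum_div]
    refine Finset.sum_congr rfl fun u _ => ?_
    simp only [B, Finset.sum_const, Finset.card_univ, Fintype.card_fin, nsmul_eq_mul, hS']
    rw [toReal_codeCost (hS u)]
    have hyu : (y u : ℝ) ≠ 0 := by exact_mod_cast (hy0 u).ne'
    have hm : ((h / y u : ℕ) : ℝ) * y u = h := by exact_mod_cast hmul u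
    change _ = (κ u : ℝ) * ((((κ u + 2 * y u + 1 : ℕ) : ℝ) + (S u).card) / (y u : ℕ))
    rw [← hm]
    rw [← hm] at hh'
    have := left_ne_zero_of_mul hh'
    field_simp

/-- Slots of four types, with code rates `1 / K` and `1 / (K + 1)` and loads `ρ` and `ρ + 1`. The
allocation depends only on the loads, so that the four types can have arbitrary numbers. -/
theorem achievesUpTo_of_counts {N : ℕ} (K ρ d₁ d₂ d₃ d₄ E : ℕ) (c : Fin N → ℕ)
    (hE : 0 < E) (hKE : K * (d₁ + d₂) + (K + 1) * (d₃ + d₄) = E)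
    (hc : ∀ n, c n ≤ d₁ + d₂ + d₃ + d₄)
    (hsum : ∑ n, c n = ρ * (d₁ + d₂ + d₃ + d₄) + (d₂ + d₄))
    (h₁ : d₁ ≠ 0 → K + 3 ≤ ρ) (h₂ : d₂ ≠ 0 → K + 3 ≤ ρ + 1) (h₃ : d₃ ≠ 0 → K + 1 + 3 ≤ ρ)
    (h₄ : d₄ ≠ 0 → K + 1 + 3 ≤ ρ + 1) (μ : Fin N → ℝ) (C ε : ℝ)
    (hμ : ∀ n, |(c n : ℝ) / E - μ n| ≤ ε)
    (hC : |(d₁ * (K * (codeCost K ρ).toReal) + d₂ * (K * (codeCost K (ρ + 1)).toReal) +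
      d₃ * ((K + 1) * (codeCost (K + 1) ρ).toReal) +
      d₄ * ((K + 1) * (codeCost (K + 1) (ρ + 1)).toReal)) / E - C| ≤ ε) :
    AchievesUpTo μ C (N + N * N) ε := by
  classical
  obtain ⟨S, hSn, hSu⟩ := exists_allocation (D := (d₂ + d₄) + (d₁ + d₃)) (d := d₂ + d₄) ρ c
    (fun n => (hc n).trans (by omega)) (by omega) (by
      rw [hsum]
      congr 2
      omega)
  let φ : (Fin d₂ ⊕ Fin d₄) ⊕ (Fin d₁ ⊕ Fin d₃) ≃ Fin ((d₂ + d₄) + (d₁ + d₃)) :=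
    (Equiv.sumCongr finSumFinEquiv finSumFinEquiv).trans finSumFinEquiv
  let κ : (Fin d₂ ⊕ Fin d₄) ⊕ (Fin d₁ ⊕ Fin d₃) → ℕ :=
    Sum.elim (Sum.elim (fun _ => K) fun _ => K + 1) (Sum.elim (fun _ => K) fun _ => K + 1)
  have hl : ∀ a, (S (φ (.inl a))).card = ρ + 1 := fun a => by
    rw [hSu, if_pos]
    simp [φ]
  have hr : ∀ a, (S (φ (.inr a))).card = ρ := fun a => by
    rw [hSu, if_neg]
    simp [φ]
  refine achievesUpTo_of_slots κ (fun u => S (φ u)) ?_ hE ?_ μ C ε (fun n => ?_) ?_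
  · rintro ((a | a) | (a | a))
    · rw [hl]
      exact h₂ a.pos.ne'
    · rw [hl]
      exact h₄ a.pos.ne'
    · rw [hr]
      exact h₁ a.pos.ne'
    · rw [hr]
      exact h₃ a.pos.ne'
  · simp only [κ, Fintype.sum_sum_type, Sum.elim_inl, Sum.elim_inr, Finset.sum_const,
      Finset.card_univ, Fintype.card_fin, smul_eq_mul, ← hKE]
    ring
  · have : (Finset.univ.filter fun u => n ∈ S (φ u)).card = c n := by
      rw [← hSn n]
      exact Finset.card_equiv φ fun u => by simp
    rw [this]
    exact hμ n
  · convert hC using 4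
    simp only [κ, Fintype.sum_sum_type, Sum.elim_inl, Sum.elim_inr, Finset.sum_const,
      Finset.card_univ, Fintype.card_fin, nsmul_eq_mul, hl, hr]
    push_cast
    ring


/-! ### From real weights to numbers of slots -/

theorem exists_common_denominator (s : Finset ℝ)
    (hs : ∀ x ∈ s, 0 ≤ x ∧ x ∈ (algebraMap ℚ ℝ).fieldRange) :
    ∃ X : ℕ, 0 < X ∧ ∀ x ∈ s, ∃ k : ℕ, (k : ℝ) = X * x := by
  classical
  induction s using Finset.induction_on with
  | empty => exact ⟨1, one_pos, by simp⟩
  | insert a s ha ih =>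
    obtain ⟨X, hX, h⟩ := ih fun x hx => hs x (Finset.mem_insert_of_mem hx)
    obtain ⟨h0, q, rfl⟩ := hs a (Finset.mem_insert_self _ _)
    refine ⟨X * q.den, Nat.mul_pos hX q.den_pos, fun x hx => ?_⟩
    rcases Finset.mem_insert.1 hx with rfl | hx
    · have hq : 0 ≤ q := by simpa using h0
      refine ⟨X * q.num.toNat, ?_⟩
      have h1 : ((q.num.toNat : ℤ) : ℝ) = q.num := by rw [Int.toNat_of_nonneg (Rat.num_nonneg.2 hq)]
      have h2 : (q.num : ℝ) = q.den * q := by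
        rw [mul_comm]
        exact_mod_cast (Rat.mul_den_eq_num q).symm
      push_cast at h1 ⊢
      rw [h1, h2, eq_ratCast, mul_assoc]
    · obtain ⟨k, hk⟩ := h x hx
      refine ⟨k * q.den, ?_⟩
      push_cast
      rw [hk]
      ring

/-- Weights of the four types of slots: `w₁, w₂` with code rate `1 / K` and `w₃, w₄` with code
rate `1 / (K + 1)`, in units of the storage of one database; slots of weights `w₁, w₃` are kept
by `ρ` databases, and those of weights `w₂, w₄` by `ρ + 1` databases. -/
structure Weights {N : ℕ} (μ : Fin N → ℝ) (K ρ : ℕ) (w₁ w₂ w₃ w₄ : ℝ) : Prop where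
  nonneg₁ : 0 ≤ w₁
  nonneg₂ : 0 ≤ w₂
  nonneg₃ : 0 ≤ w₃
  nonneg₄ : 0 ≤ w₄
  model : K * (w₁ + w₂) + (K + 1) * (w₃ + w₄) = 1
  le : ∀ n, μ n ≤ w₁ + w₂ + w₃ + w₄
  sum : ∑ n, μ n = ρ * (w₁ + w₂ + w₃ + w₄) + (w₂ + w₄)
  usable₁ : w₁ ≠ 0 → K + 3 ≤ ρ
  usable₂ : w₂ ≠ 0 → K + 3 ≤ ρ + 1
  usable₃ : w₃ ≠ 0 → K + 1 + 3 ≤ ρ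
  usable₄ : w₄ ≠ 0 → K + 1 + 3 ≤ ρ + 1

/-- The cost of a system of weights. -/
def weightsCost (K ρ : ℕ) (w₁ w₂ w₃ w₄ : ℝ) : ℝ :=
  w₁ * (K * (codeCost K ρ).toReal) + w₂ * (K * (codeCost K (ρ + 1)).toReal) +
    w₃ * ((K + 1) * (codeCost (K + 1) ρ).toReal) +
    w₄ * ((K + 1) * (codeCost (K + 1) (ρ + 1)).toReal)

namespace Weights

variable {N : ℕ} {μ : Fin N → ℝ} {K ρ : ℕ} {w₁ w₂ w₃ w₄ : ℝ}

theorem achievesUpTo_zero (h : Weights μ K ρ w₁ w₂ w₃ w₄) (hμ0 : ∀ n, 0 ≤ μ n)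
    (hμ : ∀ n, μ n ∈ (algebraMap ℚ ℝ).fieldRange) (h₁ : w₁ ∈ (algebraMap ℚ ℝ).fieldRange)
    (h₂ : w₂ ∈ (algebraMap ℚ ℝ).fieldRange) (h₃ : w₃ ∈ (algebraMap ℚ ℝ).fieldRange)
    (h₄ : w₄ ∈ (algebraMap ℚ ℝ).fieldRange) :
    AchievesUpTo μ (weightsCost K ρ w₁ w₂ w₃ w₄) (N + N * N) 0 := by
  classical
  obtain ⟨X, hX, hk⟩ := exists_common_denominator (Finset.univ.image μ ∪ {w₁, w₂, w₃, w₄}) (by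
    intro x hx
    simp only [Finset.mem_union, Finset.mem_image, Finset.mem_univ, true_and, Finset.mem_insert,
      Finset.mem_singleton] at hx
    rcases hx with ⟨n, rfl⟩ | rfl | rfl | rfl | rfl
    exacts [⟨hμ0 n, hμ n⟩, ⟨h.nonneg₁, h₁⟩, ⟨h.nonneg₂, h₂⟩, ⟨h.nonneg₃, h₃⟩, ⟨h.nonneg₄, h₄⟩])
  choose c hc using fun n => hk (μ n) (by simp)
  obtain ⟨d₁, hd₁⟩ := hk w₁ (by simp)
  obtain ⟨d₂, hd₂⟩ := hk w₂ (by simp)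
  obtain ⟨d₃, hd₃⟩ := hk w₃ (by simp)
  obtain ⟨d₄, hd₄⟩ := hk w₄ (by simp)
  have hX' : (X : ℝ) ≠ 0 := by exact_mod_cast hX.ne'
  have hne : ∀ {d : ℕ} {w : ℝ}, (d : ℝ) = X * w → d ≠ 0 → w ≠ 0 := by
    rintro d w hd h0 rfl
    simp at hd
    exact h0 hd
  refine achievesUpTo_of_counts K ρ d₁ d₂ d₃ d₄ X c hX ?_ (fun n => ?_) ?_
    (fun h0 => h.usable₁ (hne hd₁ h0)) (fun h0 => h.usable₂ (hne hd₂ h0))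
    (fun h0 => h.usable₃ (hne hd₃ h0)) (fun h0 => h.usable₄ (hne hd₄ h0)) μ _ 0 (fun n => ?_) ?_
  · have : (K * (d₁ + d₂) + (K + 1) * (d₃ + d₄) : ℝ) = X := by
      rw [hd₁, hd₂, hd₃, hd₄]
      linear_combination (X : ℝ) * h.model
    exact_mod_cast this
  · have : (c n : ℝ) ≤ d₁ + d₂ + d₃ + d₄ := by
      rw [hc, hd₁, hd₂, hd₃, hd₄]
      have := mul_le_mul_of_nonneg_left (h.le n) (Nat.cast_nonneg (α := ℝ) X)
      linarith
    exact_mod_cast this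
  · have : (∑ n, c n : ℝ) = ρ * (d₁ + d₂ + d₃ + d₄) + (d₂ + d₄) := by
      simp only [hc, ← Finset.mul_sum]
      rw [h.sum, hd₁, hd₂, hd₃, hd₄]
      ring
    exact_mod_cast this
  · rw [hc]
    field_simp
    simp
  · rw [weightsCost, hd₁, hd₂, hd₃, hd₄]
    have : ∀ a b : ℝ, a = X * b → |a / X - b| ≤ 0 := by
      rintro a b rfl
      field_simp
      simp
    apply this
    ring

theorem pos (h : Weights μ K ρ w₁ w₂ w₃ w₄) : 0 < w₁ + w₂ + w₃ + w₄ := by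
  have := h.nonneg₁
  have := h.nonneg₂
  have := h.nonneg₃
  have := h.nonneg₄
  by_contra hle
  have e₁ : w₁ = 0 := by linarith
  have e₂ : w₂ = 0 := by linarith
  have e₃ : w₃ = 0 := by linarith
  have e₄ : w₄ = 0 := by linarith
  have := h.model
  simp [e₁, e₂, e₃, e₄] at this

theorem one_le (h : Weights μ K ρ w₁ w₂ w₃ w₄) : 1 ≤ ρ := by
  by_contra hlt
  have e₁ : w₁ = 0 := by
    by_contra h0
    have := h.usable₁ h0
    omega
  have e₂ : w₂ = 0 := by
    by_contra h0
    have := h.usable₂ h0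
    omega
  have e₃ : w₃ = 0 := by
    by_contra h0
    have := h.usable₃ h0
    omega
  have e₄ : w₄ = 0 := by
    by_contra h0
    have := h.usable₄ h0
    omega
  have := h.pos
  simp [e₁, e₂, e₃, e₄] at this

/-- The numbers of slots are the weights, scaled by a large `X` and rounded down. The loads are
first taken slightly too small, and then raised to the sum that these numbers of slots need. -/
theorem achievesUpTo (h : Weights μ K ρ w₁ w₂ w₃ w₄) (hμ0 : ∀ n, 0 ≤ μ n) {ε : ℝ} (hε : 0 < ε) :
    AchievesUpTo μ (weightsCost K ρ w₁ w₂ w₃ w₄) (N + N * N) ε := by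
  have hc := h.pos
  have hρ : (1 : ℝ) ≤ ρ := by exact_mod_cast h.one_le
  obtain ⟨h₁, h₂, h₃, h₄, hmodel, hle, hsum, u₁, u₂, u₃, u₄⟩ := h
  set c := w₁ + w₂ + w₃ + w₄ with hcdef
  set p := ∑ n, μ n with hp
  -- `Y` compensates for the rounding of the numbers of slots
  set Y : ℝ := (4 * ρ + 8) / c with hY
  have hY0 : 0 < Y := by positivity
  have hYc : Y * c = 4 * ρ + 8 := by rw [hY]; field_simp
  have hp0 : ρ * c ≤ p := by rw [hsum]; linarith
  have hYp : 4 * ρ + 8 ≤ Y * p := by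
    have h1 : Y * (ρ * c) ≤ Y * p := mul_le_mul_of_nonneg_left hp0 hY0.le
    have h2 : Y * (ρ * c) = ρ * (4 * ρ + 8) := by rw [← hYc]; ring
    nlinarith
  set a₁ : ℝ := K * (codeCost K ρ).toReal with ha₁
  set a₂ : ℝ := K * (codeCost K (ρ + 1)).toReal with ha₂
  set a₃ : ℝ := (K + 1) * (codeCost (K + 1) ρ).toReal with ha₃
  set a₄ : ℝ := (K + 1) * (codeCost (K + 1) (ρ + 1)).toReal with ha₄
  have ha₁0 : 0 ≤ a₁ := by positivity
  have ha₂0 : 0 ≤ a₂ := by positivity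
  have ha₃0 : 0 ≤ a₃ := by positivity
  have ha₄0 : 0 ≤ a₄ := by positivity
  set R : ℝ := 4 * K + 2 with hR
  have hR0 : 0 ≤ R := by positivity
  set G : ℝ := (1 + w₁ * R) * a₁ + (1 + w₂ * R) * a₂ + (1 + w₃ * R) * a₃ + (1 + w₄ * R) * a₄
    with hG
  set B : ℝ := Y * c + 1 + Y * p + N + c * R with hB
  have hG0 : 0 ≤ G := by positivity
  have hp00 : 0 ≤ p := Finset.sum_nonneg fun n _ => hμ0 n
  have hB0 : 0 ≤ B := by positivity
  clear_value p Y a₁ a₂ a₃ a₄ R G B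
  obtain ⟨X, hX⟩ := exists_nat_ge ((G + B) / ε + R + 1 + Y)
  have hGB : 0 ≤ (G + B) / ε := by positivity
  have hXY : Y ≤ X := by linarith
  have hX0 : (0 : ℝ) ≤ X := Nat.cast_nonneg X
  have round : ∀ w : ℝ, 0 ≤ w → ∃ d : ℕ, X * w - 1 ≤ d ∧ (d : ℝ) ≤ X * w ∧ (d ≠ 0 → w ≠ 0) :=
    fun w hw => ⟨⌊X * w⌋₊, (Nat.sub_one_lt_floor _).le, Nat.floor_le (mul_nonneg hX0 hw), by
      rintro h0 rfl
      simp at h0⟩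
  obtain ⟨d₁, l₁, i₁, n₁⟩ := round w₁ h₁
  obtain ⟨d₂, l₂, i₂, n₂⟩ := round w₂ h₂
  obtain ⟨d₃, l₃, i₃, n₃⟩ := round w₃ h₃
  obtain ⟨d₄, l₄, i₄, n₄⟩ := round w₄ h₄
  obtain ⟨E, hE⟩ : ∃ E, E = K * (d₁ + d₂) + (K + 1) * (d₃ + d₄) := ⟨_, rfl⟩
  have hEr : (E : ℝ) = K * (d₁ + d₂) + (K + 1) * (d₃ + d₄) := by rw [hE]; push_cast; ring
  have hXm : (X : ℝ) = K * (X * w₁ + X * w₂) + (K + 1) * (X * w₃ + X * w₄) := by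
    linear_combination -(X : ℝ) * hmodel
  have hK0 : (0 : ℝ) ≤ K := Nat.cast_nonneg K
  have hEX : (E : ℝ) ≤ X := by
    rw [hEr, hXm]
    gcongr
  have hXE : X - R ≤ E := by
    have e1 := mul_le_mul_of_nonneg_left (add_le_add l₁ l₂) hK0
    have e2 := mul_le_mul_of_nonneg_left (add_le_add l₃ l₄) (by positivity : (0 : ℝ) ≤ K + 1)
    rw [hEr, hR]
    linarith
  have hEB : (G + B) / ε ≤ E := by linarith
  have hE0 : (0 : ℝ) < E := by linarith
  have hdiv : ∀ a b : ℝ, a / E - b = (a - E * b) / E := fun a b => by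
    rw [sub_div, mul_div_cancel_left₀ _ hE0.ne']
  have hEB' : G + B ≤ ε * E := by rwa [div_le_iff₀' hε] at hEB
  -- the loads
  have hXYμ : ∀ n, 0 ≤ (X - Y) * μ n := fun n => mul_nonneg (by linarith) (hμ0 n)
  set e : Fin N → ℕ := fun n => ⌊(X - Y) * μ n⌋₊ with he
  have ehi : ∀ n, (e n : ℝ) ≤ (X - Y) * μ n := fun n => Nat.floor_le (hXYμ n)
  have elo : ∀ n, (X - Y) * μ n - 1 ≤ e n := fun n => (Nat.sub_one_lt_floor _).le
  have eD : ∀ n, e n ≤ d₁ + d₂ + d₃ + d₄ := by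
    intro n
    have h1 : (X - Y) * μ n ≤ (X - Y) * c := mul_le_mul_of_nonneg_left (hle n) (by linarith)
    have : (e n : ℝ) ≤ d₁ + d₂ + d₃ + d₄ := by
      have := ehi n
      have : X * c = X * w₁ + X * w₂ + X * w₃ + X * w₄ := by rw [hcdef]; ring
      linarith
    exact_mod_cast this
  set P := ρ * (d₁ + d₂ + d₃ + d₄) + (d₂ + d₄) with hP
  have hXp : X * p = ρ * (X * w₁ + X * w₂ + X * w₃ + X * w₄) + (X * w₂ + X * w₄) := by
    rw [hsum, hcdef]; ring
  have hPlo : X * p - (4 * ρ + 2) ≤ (P : ℝ) := by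
    rw [hP, hXp]
    push_cast
    have := mul_le_mul_of_nonneg_left (add_le_add (add_le_add (add_le_add l₁ l₂) l₃) l₄)
      (by linarith : (0 : ℝ) ≤ ρ)
    linarith
  have hPhi : (P : ℝ) ≤ X * p := by
    rw [hP, hXp]
    push_cast
    gcongr
  have hsumhi : (∑ n, (e n : ℝ)) ≤ (X - Y) * p := by
    rw [hp, Finset.mul_sum]
    exact Finset.sum_le_sum fun n _ => ehi n
  have hsumlo : (X - Y) * p - N ≤ ∑ n, (e n : ℝ) := by
    have : ∑ n : Fin N, ((X - Y) * μ n - 1) ≤ ∑ n, (e n : ℝ) :=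
      Finset.sum_le_sum fun n _ => elo n
    simpa [Finset.sum_sub_distrib, ← Finset.mul_sum, ← hp] using this
  have heP : ∑ n, e n ≤ P := by
    have : (∑ n, (e n : ℝ)) ≤ P := by linarith
    exact_mod_cast this
  obtain ⟨k, hk⟩ := Nat.exists_eq_add_of_le heP
  have hkr : (P : ℝ) = ∑ n, (e n : ℝ) + k := by exact_mod_cast hk
  -- a slot is kept by at most `N` databases
  have hPN : P ≤ N * (d₁ + d₂ + d₃ + d₄) := by
    have hpN : p ≤ N * c := by
      have : ∑ n, μ n ≤ ∑ n : Fin N, c := Finset.sum_le_sum fun n _ => hle n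
      simpa [← hp] using this
    have hρN : ρ ≤ N := by
      have : ρ * c ≤ N * c := by linarith
      exact_mod_cast le_of_mul_le_mul_right this hc
    rcases hρN.eq_or_lt with hρN | hρN
    · have h24 : w₂ + w₄ ≤ 0 := by
        rw [← hρN] at hpN
        linarith
      have e2 : d₂ = 0 := by
        by_contra h0
        exact n₂ h0 (by linarith)
      have e4 : d₄ = 0 := by
        by_contra h0
        exact n₄ h0 (by linarith)
      rw [hP, hρN, e2, e4]
      omega
    · have : (ρ + 1) * (d₁ + d₂ + d₃ + d₄) ≤ N * (d₁ + d₂ + d₃ + d₄) :=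
        Nat.mul_le_mul_right _ hρN
      rw [add_mul] at this
      omega
  obtain ⟨f, hfD, hef, hfe, hfsum⟩ := exists_raise e eD k (hk ▸ hPN)
  refine achievesUpTo_of_counts K ρ d₁ d₂ d₃ d₄ E f (by exact_mod_cast hE0) hE.symm hfD
    (by rw [hfsum, ← hk]) (fun h0 => u₁ (n₁ h0)) (fun h0 => u₂ (n₂ h0))
    (fun h0 => u₃ (n₃ h0)) (fun h0 => u₄ (n₄ h0)) μ _ ε (fun n => ?_) ?_
  · have hfn1 : (e n : ℝ) ≤ f n := by exact_mod_cast hef n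
    have hfn2 : (f n : ℝ) ≤ e n + k := by exact_mod_cast hfe n
    have hn1 := ehi n
    have hn2 := elo n
    have hYμ : Y * μ n ≤ Y * c := mul_le_mul_of_nonneg_left (hle n) hY0.le
    have hYμ0 : 0 ≤ Y * μ n := mul_nonneg hY0.le (hμ0 n)
    have hμR : μ n * (X - E) ≤ c * R :=
      mul_le_mul (hle n) (by linarith) (by linarith) hc.le
    have hμR0 : 0 ≤ μ n * (X - E) := mul_nonneg (hμ0 n) (by linarith)
    have hN0 : (0 : ℝ) ≤ N := Nat.cast_nonneg N
    have hYc0 : 0 ≤ Y * c := by positivity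
    rw [hdiv, abs_div, abs_of_pos hE0, div_le_iff₀ hE0, abs_le]
    constructor <;> linarith
  · have key : ∀ (d w a : ℝ), 0 ≤ w → 0 ≤ a → X * w - 1 ≤ d → d ≤ X * w →
        |d * a - E * (w * a)| ≤ (1 + w * R) * a := by
      intro d w a hw ha hl hh
      have hwR : w * (X - E) ≤ w * R := mul_le_mul_of_nonneg_left (by linarith) hw
      have hwR0 : 0 ≤ w * (X - E) := mul_nonneg hw (by linarith)
      have : d * a - E * (w * a) = (d - E * w) * a := by ring
      rw [this, abs_mul, abs_of_nonneg ha]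
      refine mul_le_mul_of_nonneg_right (abs_le.2 ⟨?_, ?_⟩) ha <;> linarith
    have k₁ := abs_le.1 (key d₁ w₁ a₁ h₁ ha₁0 l₁ i₁)
    have k₂ := abs_le.1 (key d₂ w₂ a₂ h₂ ha₂0 l₂ i₂)
    have k₃ := abs_le.1 (key d₃ w₃ a₃ h₃ ha₃0 l₃ i₃)
    have k₄ := abs_le.1 (key d₄ w₄ a₄ h₄ ha₄0 l₄ i₄)
    rw [weightsCost, ← ha₁, ← ha₂, ← ha₃, ← ha₄, hdiv, abs_div, abs_of_pos hE0, div_le_iff₀ hE0, abs_le]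
    constructor <;> linarith [k₁.1, k₁.2, k₂.1, k₂.2, k₃.1, k₃.2, k₄.1, k₄.2]

end Weights

/-! ### The weights of the optimal costs -/

theorem usable_of_term_ne_top {a : ℝ} {m n : ℕ} (ha : 0 ≤ a) (ha0 : a ≠ 0)
    (h : ENNReal.ofReal a * codeCost m n ≠ ∞) : m + 3 ≤ n := by
  rw [← codeCost_ne_top_iff]
  intro htop
  rw [htop, ENNReal.mul_top (by simpa using lt_of_le_of_ne ha ha0.symm)] at h
  exact h rfl

theorem toReal_term {a : ℝ} (ha : 0 ≤ a) (m n : ℕ) :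
    (ENNReal.ofReal a * codeCost m n).toReal = a * (codeCost m n).toReal := by
  rw [ENNReal.toReal_mul, ENNReal.toReal_ofReal ha]

theorem ceil_eq_floor_add_one {x : ℝ} (hx : 0 ≤ x) (h : x ≠ ⌊x⌋₊) : ⌈x⌉₊ = ⌊x⌋₊ + 1 := by
  rw [Nat.ceil_eq_iff (by omega)]
  exact ⟨by simpa using lt_of_le_of_ne (Nat.floor_le hx) h.symm,
    by exact_mod_cast (Nat.lt_floor_add_one x).le⟩

section

variable {N : ℕ} {μ : Fin N → ℝ}

theorem exists_kk_eq (hN : 0 < N) :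
    ∃ n₀, kk μ = 1 / μ n₀ ∧ ∀ n, μ n ≤ μ n₀ := by
  have : Nonempty (Fin N) := ⟨⟨0, hN⟩⟩
  obtain ⟨n₀, hn₀⟩ := exists_eq_ciSup_of_finite (f := μ)
  refine ⟨n₀, by rw [kk, hn₀], fun n => ?_⟩
  rw [hn₀]
  exact le_ciSup (Set.finite_range μ).bddAbove n

theorem one_le_kk (hN : 0 < N) (hμ : ∀ n, 0 < μ n ∧ μ n ≤ 1) : 1 ≤ kk μ := by
  obtain ⟨n₀, h, -⟩ := exists_kk_eq (μ := μ) hN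
  rw [h, le_div_iff₀ (hμ n₀).1, one_mul]
  exact (hμ n₀).2

theorem le_one_div_kk (hN : 0 < N) (n : Fin N) :
    μ n ≤ 1 / kk μ := by
  obtain ⟨n₀, h, hle⟩ := exists_kk_eq (μ := μ) hN
  rw [h, one_div_one_div]
  exact hle n

theorem one_le_floor_kk (hN : 0 < N) (hμ : ∀ n, 0 < μ n ∧ μ n ≤ 1) : 1 ≤ ⌊kk μ⌋₊ :=
  Nat.le_floor (by exact_mod_cast one_le_kk hN hμ)

theorem pp_nonneg (hμ : ∀ n, 0 < μ n ∧ μ n ≤ 1) : 0 ≤ pp μ :=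
  Finset.sum_nonneg fun n _ => (hμ n).1.le

/-- The weights of `C₁`: the whole model is `⌊k⌋` coded. -/
theorem weights_cost₁ (hN : 0 < N) (hμ : ∀ n, 0 < μ n ∧ μ n ≤ 1) (hC : cost₁ μ ≠ ∞) :
    Weights μ ⌊kk μ⌋₊ ⌊ss μ⌋₊ ((⌊ss μ⌋₊ + 1 - ss μ) / ⌊kk μ⌋₊) ((ss μ - ⌊ss μ⌋₊) / ⌊kk μ⌋₊) 0 0 ∧
    weightsCost ⌊kk μ⌋₊ ⌊ss μ⌋₊ ((⌊ss μ⌋₊ + 1 - ss μ) / ⌊kk μ⌋₊) ((ss μ - ⌊ss μ⌋₊) / ⌊kk μ⌋₊)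
      0 0 = (cost₁ μ).toReal := by
  have hK : (0 : ℝ) < ⌊kk μ⌋₊ := by exact_mod_cast one_le_floor_kk hN hμ
  have hKk : (⌊kk μ⌋₊ : ℝ) ≤ kk μ := Nat.floor_le (by linarith [one_le_kk hN hμ])
  have hs0 : 0 ≤ ss μ := mul_nonneg hK.le (pp_nonneg hμ)
  have ha : 0 ≤ ⌊ss μ⌋₊ + 1 - ss μ := by linarith [Nat.lt_floor_add_one (ss μ)]
  have hb : 0 ≤ ss μ - ⌊ss μ⌋₊ := by linarith [Nat.floor_le hs0]
  rw [cost₁] at hC ⊢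
  obtain ⟨ht₁, ht₂⟩ := ENNReal.add_ne_top.1 hC
  have hceil : ss μ - ⌊ss μ⌋₊ ≠ 0 → ⌈ss μ⌉₊ = ⌊ss μ⌋₊ + 1 := fun h =>
    ceil_eq_floor_add_one hs0 (sub_ne_zero.1 h)
  constructor
  · refine ⟨by positivity, by positivity, le_rfl, le_rfl, ?_, fun n => ?_, ?_, fun h => ?_,
      fun h => ?_, fun h => absurd rfl h, fun h => absurd rfl h⟩
    · field_simp
      ring
    · refine (le_one_div_kk hN n).trans ((one_div_le_one_div_of_le hK hKk).trans (le_of_eq ?_))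
      field_simp
      ring
    · have : ∑ n, μ n = ss μ / ⌊kk μ⌋₊ := by
        rw [ss, mul_div_cancel_left₀ _ hK.ne']
        rfl
      rw [this]
      field_simp
      ring
    · exact usable_of_term_ne_top ha (fun h0 => h (by simp [h0])) ht₁
    · have h0 : ss μ - ⌊ss μ⌋₊ ≠ 0 := fun h0 => h (by simp [h0])
      have := usable_of_term_ne_top hb h0 ht₂
      rwa [hceil h0] at this
  · rw [ENNReal.toReal_add ht₁ ht₂, toReal_term ha, toReal_term hb, weightsCost]
    have : (ss μ - ⌊ss μ⌋₊) * (codeCost ⌊kk μ⌋₊ ⌈ss μ⌉₊).toReal =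
        (ss μ - ⌊ss μ⌋₊) * (codeCost ⌊kk μ⌋₊ (⌊ss μ⌋₊ + 1)).toReal := by
      by_cases h0 : ss μ - ⌊ss μ⌋₊ = 0
      · simp [h0]
      · rw [hceil h0]
    rw [this]
    field_simp
    ring

/-- Sharing of the model between the code rates `1 / K` and `1 / (K + 1)`, in the proportion
`α : 1 - α`. -/
theorem weights_of_fractions (hN : 0 < N) (hμ : ∀ n, 0 < μ n ∧ μ n ≤ 1) {K ρ r' : ℕ}
    (hK : 0 < K) {α β δ : ℝ} (hα0 : 0 ≤ α) (hα1 : α ≤ 1) (hβ0 : 0 ≤ β) (hβ1 : β ≤ 1)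
    (hδ0 : 0 ≤ δ) (hδ1 : δ ≤ 1) (hle : K * (K + 1 - kk μ) ≤ kk μ * α)
    (hsum : pp μ * (K * (K + 1)) =
      ρ * (α + K) + (α * (1 - β) * (K + 1) + (1 - α) * (1 - δ) * K))
    (hr' : r' = ρ + 1 ∨ β = 1 ∧ δ = 1) {C : ℝ≥0∞}
    (hC : C = ENNReal.ofReal (α * β) * codeCost K ρ +
      ENNReal.ofReal (α * (1 - β)) * codeCost K r' +
      ENNReal.ofReal ((1 - α) * δ) * codeCost (K + 1) ρ +
      ENNReal.ofReal ((1 - α) * (1 - δ)) * codeCost (K + 1) r') (hC' : C ≠ ∞) :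
    Weights μ K ρ (α * β / K) (α * (1 - β) / K) ((1 - α) * δ / (K + 1))
      ((1 - α) * (1 - δ) / (K + 1)) ∧
    weightsCost K ρ (α * β / K) (α * (1 - β) / K) ((1 - α) * δ / (K + 1))
      ((1 - α) * (1 - δ) / (K + 1)) = C.toReal := by
  have hk1 := one_le_kk hN hμ
  have hK0 : (0 : ℝ) < K := by exact_mod_cast hK
  have p₁ : 0 ≤ α * β := mul_nonneg hα0 hβ0
  have p₂ : 0 ≤ α * (1 - β) := mul_nonneg hα0 (by linarith)
  have p₃ : 0 ≤ (1 - α) * δ := mul_nonneg (by linarith) hδ0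
  have p₄ : 0 ≤ (1 - α) * (1 - δ) := mul_nonneg (by linarith) (by linarith)
  subst hC
  obtain ⟨hC', t₄⟩ := ENNReal.add_ne_top.1 hC'
  obtain ⟨hC'', t₃⟩ := ENNReal.add_ne_top.1 hC'
  obtain ⟨t₁, t₂⟩ := ENNReal.add_ne_top.1 hC''
  constructor
  · refine ⟨by positivity, by positivity, by positivity, by positivity, ?_, fun n => ?_, ?_,
      fun h => ?_, fun h => ?_, fun h => ?_, fun h => ?_⟩
    · field_simp
      ring
    · refine (le_one_div_kk hN n).trans ?_
      have : α * β / K + α * (1 - β) / K + (1 - α) * δ / (K + 1) + (1 - α) * (1 - δ) / (K + 1) =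
          (α + K) / (K * (K + 1)) := by
        field_simp
        ring
      rw [this, div_le_div_iff₀ (by linarith) (by positivity)]
      linarith
    · change pp μ = _
      have : (K * (K + 1) : ℝ) ≠ 0 := by positivity
      refine mul_right_cancel₀ this ?_
      rw [hsum]
      field_simp
      ring
    · exact usable_of_term_ne_top p₁ (fun h0 => h (by simp [h0])) t₁
    · have := usable_of_term_ne_top p₂ (fun h0 => h (by simp [h0])) t₂
      rcases hr' with rfl | ⟨rfl, rfl⟩
      · exact this
      · simp at h
    · exact usable_of_term_ne_top p₃ (fun h0 => h (by simp [h0])) t₃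
    · have := usable_of_term_ne_top p₄ (fun h0 => h (by simp [h0])) t₄
      rcases hr' with rfl | ⟨rfl, rfl⟩
      · exact this
      · simp at h
  · rw [ENNReal.toReal_add hC' t₄, ENNReal.toReal_add hC'' t₃, ENNReal.toReal_add t₁ t₂,
      toReal_term p₁, toReal_term p₂, toReal_term p₃, toReal_term p₄, weightsCost]
    rcases hr' with rfl | ⟨rfl, rfl⟩
    · field_simp
    · simp
      field_simp

open Classical in
/-- If `k` is an integer, `C₂` does not improve on `C₁`: the two are equal, except that for odd
`⌊r⌋ - k` and fractional `r` the fractions put all the weight of `C₂` on `C_T(k, ⌈r⌉)`, which is at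
least `C_T(k, ⌊r⌋)`. -/
theorem cost₁_le_cost₂ (hN : 0 < N) (hμ : ∀ n, 0 < μ n ∧ μ n ≤ 1) (hk : kk μ = ⌊kk μ⌋₊) :
    cost₁ μ ≤ cost₂ μ := by
  have hK : (0 : ℝ) < ⌊kk μ⌋₊ := by exact_mod_cast one_le_floor_kk hN hμ
  have hceil : ⌈kk μ⌉₊ = ⌊kk μ⌋₊ := by
    conv_lhs => rw [hk]
    exact Nat.ceil_natCast _
  have hsr : ss μ = rr μ := by rw [ss, rr, ← hk]
  have hr0 : 0 ≤ rr μ := by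
    rw [← hsr]
    exact mul_nonneg hK.le (pp_nonneg hμ)
  have hfl := Nat.floor_le hr0
  have hα : fracα μ = if OddCase μ then 0 else rr μ - ⌊rr μ⌋₊ := by
    rw [fracα, hceil, hsr, ← hk, sub_self, mul_zero]
    split_ifs with h1 h2 h3
    · linarith [h2.1, h2.2]
    · rfl
    · linarith
    · rcases eq_or_ne (rr μ) ⌊rr μ⌋₊ with hr | hr
      · have : ⌈rr μ⌉₊ = ⌊rr μ⌋₊ := by
          conv_lhs => rw [hr]
          exact Nat.ceil_natCast _
        rw [this, sub_self, div_zero, ← hr, sub_self]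
      · rw [ceil_eq_floor_add_one hr0 hr]
        have hk0 : kk μ ≠ 0 := by rw [hk]; exact hK.ne'
        push_cast
        rw [div_eq_iff (by ring_nf; exact hk0), rr]
        ring
  rw [cost₁, cost₂, hα, hsr, hceil]
  by_cases hodd : OddCase μ
  · have hδ : fracδ μ = if rr μ = ⌊rr μ⌋₊ then 1 else 0 := by
      rw [fracδ, if_pos hodd, ← hk, sub_self, div_zero, sub_zero]
      refine if_congr ⟨fun h => le_antisymm (by linarith) hfl, fun h => by linarith⟩ rfl rfl
    rw [if_pos hodd, hδ]
    rcases eq_or_ne (rr μ) ⌊rr μ⌋₊ with hr | hr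
    · rw [if_pos hr, ← hr]
      simp
    · rw [if_neg hr]
      simp only [ceil_eq_floor_add_one hr0 hr, zero_mul, ENNReal.ofReal_zero, sub_zero, mul_zero,
        one_mul, mul_one, ENNReal.ofReal_one, zero_add]
      have hmono : codeCost ⌊kk μ⌋₊ ⌊rr μ⌋₊ ≤ codeCost ⌊kk μ⌋₊ (⌊rr μ⌋₊ + 1) := by
        by_cases h3 : ⌊kk μ⌋₊ + 3 ≤ ⌊rr μ⌋₊
        · have hodd' : Odd (⌊rr μ⌋₊ - ⌊kk μ⌋₊) := by
            have := hodd
            rw [OddCase, ← Nat.cast_sub (by omega)] at this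
            exact_mod_cast this
          obtain ⟨a, ha⟩ := hodd'
          have e1 : (⌊rr μ⌋₊ - ⌊kk μ⌋₊ - 1) / 2 = a := by omega
          have e2 : (⌊rr μ⌋₊ + 1 - ⌊kk μ⌋₊ - 1) / 2 = a := by omega
          rw [codeCost_eq h3, codeCost_eq (by omega), e1, e2]
          refine ENNReal.ofReal_le_ofReal ?_
          push_cast
          gcongr
          linarith
        · have h4 : ⌊rr μ⌋₊ + 1 < ⌊kk μ⌋₊ + 3 := by
            by_contra h4
            have h5 : ⌊rr μ⌋₊ = ⌊kk μ⌋₊ + 2 := by omega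
            rw [OddCase, h5] at hodd
            push_cast at hodd
            rw [add_sub_cancel_left] at hodd
            exact absurd hodd (by decide)
          rw [codeCost_eq_top h4]
          exact le_top
      refine (add_le_add_left (mul_le_mul_right hmono _) _).trans ?_
      rw [← add_mul, ← ENNReal.ofReal_add (by linarith [Nat.lt_floor_add_one (rr μ)])
        (by linarith)]
      simp
  · have hδ : fracδ μ = 1 := if_neg hodd
    have hβ : fracβ μ = 0 := by
      rw [fracβ, if_neg hodd, if_neg]
      rw [hceil, ← hk, sub_self]
      linarith
    rw [if_neg hodd, hδ, hβ]
    simp only [mul_zero, sub_zero, mul_one, sub_self, ENNReal.ofReal_zero, zero_mul, zero_add,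
      add_zero]
    rw [add_comm, show (⌊rr μ⌋₊ + 1 - rr μ : ℝ) = 1 - (rr μ - ⌊rr μ⌋₊) by ring]

/-- If `k` is not an integer and `C₂` is finite, the fractions `α`, `β`, `δ` are feasible. The
fourth clause says that the slots hold as much as the largest database,
`1 / k ≤ α / K + (1 - α) / (K + 1)`; the fifth one says that the total load is `p`. -/
theorem fractions_feasible (hN : 0 < N) (hμ : ∀ n, 0 < μ n ∧ μ n ≤ 1) (hk : kk μ ≠ ⌊kk μ⌋₊)
    (hC : cost₂ μ ≠ ∞) :
    (0 ≤ fracα μ ∧ fracα μ ≤ 1) ∧ (0 ≤ fracβ μ ∧ fracβ μ ≤ 1) ∧ (0 ≤ fracδ μ ∧ fracδ μ ≤ 1) ∧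
    ⌊kk μ⌋₊ * (⌊kk μ⌋₊ + 1 - kk μ) ≤ kk μ * fracα μ ∧
    pp μ * (⌊kk μ⌋₊ * (⌊kk μ⌋₊ + 1)) = ⌊rr μ⌋₊ * (fracα μ + ⌊kk μ⌋₊) +
      (fracα μ * (1 - fracβ μ) * (⌊kk μ⌋₊ + 1) + (1 - fracα μ) * (1 - fracδ μ) * ⌊kk μ⌋₊) ∧
    (⌈rr μ⌉₊ = ⌊rr μ⌋₊ + 1 ∨ fracβ μ = 1 ∧ fracδ μ = 1) := by
  have hk1 := one_le_kk hN hμ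
  have hK : (0 : ℝ) < ⌊kk μ⌋₊ := by exact_mod_cast one_le_floor_kk hN hμ
  have hK1 : (1 : ℝ) ≤ ⌊kk μ⌋₊ := by exact_mod_cast one_le_floor_kk hN hμ
  have hceil := ceil_eq_floor_add_one (by linarith) hk
  have hf0 : (⌊kk μ⌋₊ : ℝ) < kk μ := lt_of_le_of_ne (Nat.floor_le (by linarith)) hk.symm
  have hf1 := Nat.lt_floor_add_one (kk μ)
  have hr0 : 0 ≤ rr μ := mul_nonneg (by linarith) (pp_nonneg hμ)
  have hg0 := Nat.floor_le hr0
  have hg1 := Nat.lt_floor_add_one (rr μ)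
  -- some code is usable, hence `⌊r⌋ ≥ ⌊k⌋ + 2`
  have hρ : ⌊kk μ⌋₊ + 2 ≤ ⌊rr μ⌋₊ := by
    by_contra hlt
    have hrc : ⌈rr μ⌉₊ ≤ ⌊rr μ⌋₊ + 1 := Nat.ceil_le_floor_add_one _
    rw [cost₂, codeCost_eq_top (by omega), codeCost_eq_top (by omega), codeCost_eq_top (by omega),
      codeCost_eq_top (by omega)] at hC
    have hneg : ∀ a : ℝ, ENNReal.ofReal a * ∞ ≠ ∞ → a ≤ 0 := fun a ha => by
      by_contra h0
      exact ha (ENNReal.mul_top (by simpa using h0))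
    obtain ⟨hC, h4⟩ := ENNReal.add_ne_top.1 hC
    obtain ⟨hC, h3⟩ := ENNReal.add_ne_top.1 hC
    obtain ⟨h1, h2⟩ := ENNReal.add_ne_top.1 hC
    linarith [hneg _ h1, hneg _ h2, hneg _ h3, hneg _ h4]
  have hρ' : (⌊kk μ⌋₊ : ℝ) + 2 ≤ ⌊rr μ⌋₊ := by exact_mod_cast hρ
  have hrk : rr μ = kk μ * pp μ := rfl
  have hsK : ss μ = ⌊kk μ⌋₊ * pp μ := rfl
  have hp1 : 1 < pp μ := by
    by_contra hle
    have := mul_le_mul_of_nonneg_left (not_lt.1 hle) (by linarith : 0 ≤ kk μ)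
    linarith
  have hrc : rr μ ≠ ⌊rr μ⌋₊ → ⌈rr μ⌉₊ = ⌊rr μ⌋₊ + 1 := ceil_eq_floor_add_one hr0
  rw [fracα, fracβ, fracδ, hceil]
  generalize (ss μ) = s at *
  generalize (rr μ) = r at *
  generalize (kk μ) = k at *
  generalize (pp μ) = p at *
  generalize ⌊k⌋₊ = K at *
  generalize ⌊r⌋₊ = ρ at *
  have hk0 : 0 < k := by linarith
  have hb0 : 0 < (K : ℝ) + 1 - k := by linarith
  have ha0 : 0 < k - (K : ℝ) := by linarith
  push_cast
  have hα : (0 ≤ (K : ℝ) / k * (K + 1 - k) ∧ (K : ℝ) / k * (K + 1 - k) ≤ 1) ∧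
      (K : ℝ) * (K + 1 - k) ≤ k * (K / k * (K + 1 - k)) := by
    refine ⟨⟨by positivity, ?_⟩, le_of_eq (by field_simp)⟩
    rw [div_mul_eq_mul_div, div_le_one hk0]
    nlinarith
  by_cases hodd : OddCase μ
  · simp only [if_pos hodd]
    by_cases hgf : r - ρ > k - K
    · have hr := hrc (by linarith : (ρ : ℝ) < r).ne'
      rw [hr]
      have hδ : ¬ (r - ρ ≤ k - K) := not_le.2 hgf
      by_cases hs : s ≤ ρ
      · -- `s ≤ ⌊r⌋`: the databases do not fill up with `α = ⌊k⌋ / k * (⌈k⌉ - k)`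
        rw [if_pos ⟨hgf, hs⟩, if_neg (fun h => (not_lt.2 hs) h.2), if_neg hδ]
        push_cast
        have hden : ((K : ℝ) + 1) * ρ - K * (ρ + 1) = ρ - K := by ring
        have hd0 : (0 : ℝ) < ρ - K := by linarith
        rw [hden]
        refine ⟨⟨?_, ?_⟩, ⟨by norm_num, by norm_num⟩, ⟨by norm_num, by norm_num⟩, ?_, ?_,
          Or.inl rfl⟩
        · refine div_nonneg (mul_nonneg hK.le ?_) hd0.le
          nlinarith
        · rw [div_le_one hd0]
          nlinarith
        · rw [← mul_div_assoc, le_div_iff₀ hd0]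
          have : k * (K * (p * (K + 1) - (ρ + 1))) - K * (K + 1 - k) * (ρ - K) =
              K * ((K + 1) * ((r - ρ) - (k - K))) := by
            rw [hrk]; ring
          have h2 : 0 ≤ (K : ℝ) * ((K + 1) * ((r - ρ) - (k - K))) :=
            mul_nonneg hK.le (mul_nonneg (by linarith) (by linarith))
          linarith
        · field_simp
          ring
      · rw [if_neg (fun h => hs h.2), if_pos ⟨hgf, not_le.1 hs⟩, if_neg hδ]
        push_cast
        refine ⟨hα.1, ⟨div_nonneg (by linarith) hb0.le, (div_le_one hb0).2 (by linarith)⟩,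
          ⟨le_rfl, zero_le_one⟩, hα.2, ?_, Or.inl rfl⟩
        rw [hrk]
        field_simp
        ring
    · rw [if_neg (fun h => hgf h.1), if_neg (fun h => hgf h.1), if_pos (not_lt.1 hgf)]
      have hgf := not_lt.1 hgf
      have hd0 : 0 ≤ (r - ρ) / (k - K) := div_nonneg (by linarith) ha0.le
      have hd1 : (r - ρ) / (k - K) ≤ 1 := (div_le_one ha0).2 hgf
      refine ⟨hα.1, ⟨zero_le_one, le_rfl⟩, ⟨by linarith, by linarith⟩, hα.2, ?_, ?_⟩
      · rw [hrk]
        field_simp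
        ring
      · by_cases hr : r = ρ
        · exact Or.inr ⟨rfl, by simp [hr]⟩
        · exact Or.inl (hrc hr)
  · simp only [if_neg hodd]
    by_cases hgf : r - ρ < K + 1 - k
    · rw [if_pos hgf, if_pos hgf]
      have hd0 : 0 ≤ (r - ρ) / (K + 1 - k) := div_nonneg (by linarith) hb0.le
      have hd1 : (r - ρ) / (K + 1 - k) ≤ 1 := (div_le_one hb0).2 hgf.le
      refine ⟨hα.1, ⟨by linarith, by linarith⟩, ⟨zero_le_one, le_rfl⟩, hα.2, ?_, ?_⟩
      · rw [hrk]
        field_simp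
        ring
      · by_cases hr : r = ρ
        · exact Or.inr ⟨by simp [hr], trivial⟩
        · exact Or.inl (hrc hr)
    · have hr := hrc (by linarith : (ρ : ℝ) < r).ne'
      rw [if_neg hgf, if_neg hgf, hr]
      push_cast
      have hden : ((K : ℝ) + 1) * (ρ + 1) - K * ρ = ρ + K + 1 := by ring
      have hd0 : (0 : ℝ) < ρ + K + 1 := by linarith
      rw [hden]
      refine ⟨⟨?_, ?_⟩, ⟨le_rfl, zero_le_one⟩, ⟨zero_le_one, le_rfl⟩, ?_, ?_, Or.inl rfl⟩
      · refine div_nonneg (mul_nonneg hK.le ?_) hd0.le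
        nlinarith
      · rw [div_le_one hd0]
        have : (K : ℝ) * p ≤ ρ + 1 := by nlinarith
        nlinarith
      · rw [← mul_div_assoc, le_div_iff₀ hd0]
        have : k * (K * (p * (K + 1) - ρ)) - K * (K + 1 - k) * (ρ + K + 1) =
            K * ((K + 1) * ((r - ρ) - (K + 1 - k))) := by
          rw [hrk]; ring
        have h2 : 0 ≤ (K : ℝ) * ((K + 1) * ((r - ρ) - (K + 1 - k))) :=
          mul_nonneg hK.le (mul_nonneg (by linarith) (by linarith))
        linarith
      · field_simp
        ring

/-- If all capacities are rational, so are all the parameters. -/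
theorem parameters_rational (hN : 0 < N)
    (hq : ∀ n, μ n ∈ (algebraMap ℚ ℝ).fieldRange) :
    ss μ ∈ (algebraMap ℚ ℝ).fieldRange ∧ fracα μ ∈ (algebraMap ℚ ℝ).fieldRange ∧
      fracβ μ ∈ (algebraMap ℚ ℝ).fieldRange ∧ fracδ μ ∈ (algebraMap ℚ ℝ).fieldRange := by
  have hk : kk μ ∈ (algebraMap ℚ ℝ).fieldRange := by
    obtain ⟨n₀, h, -⟩ := exists_kk_eq (μ := μ) hN
    rw [h]
    exact div_mem (one_mem _) (hq n₀)
  have hp : pp μ ∈ (algebraMap ℚ ℝ).fieldRange := sum_mem fun n _ => hq n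
  have hr : rr μ ∈ (algebraMap ℚ ℝ).fieldRange := mul_mem hk hp
  have hs : ss μ ∈ (algebraMap ℚ ℝ).fieldRange := mul_mem (natCast_mem _ _) hp
  refine ⟨hs, ?_, ?_, ?_⟩
  · rw [fracα]
    split_ifs <;> repeat' first
      | assumption | exact natCast_mem _ _ | apply div_mem | apply mul_mem | apply sub_mem
  · rw [fracβ]
    split_ifs <;> repeat' first
      | assumption | exact natCast_mem _ _ | exact one_mem _ | exact zero_mem _ | apply div_mem
      | apply sub_mem
  · rw [fracδ]
    split_ifs <;> repeat' first
      | assumption | exact natCast_mem _ _ | exact one_mem _ | exact zero_mem _ | apply div_mem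
      | apply sub_mem

theorem exists_weights_minCost (hN : 0 < N) (hμ : ∀ n, 0 < μ n ∧ μ n ≤ 1)
    (hC : minCost μ ≠ ∞) :
    ∃ (K ρ : ℕ) (w₁ w₂ w₃ w₄ : ℝ), Weights μ K ρ w₁ w₂ w₃ w₄ ∧
      weightsCost K ρ w₁ w₂ w₃ w₄ = (minCost μ).toReal ∧
      ((∀ n, μ n ∈ (algebraMap ℚ ℝ).fieldRange) → w₁ ∈ (algebraMap ℚ ℝ).fieldRange ∧
        w₂ ∈ (algebraMap ℚ ℝ).fieldRange ∧ w₃ ∈ (algebraMap ℚ ℝ).fieldRange ∧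
        w₄ ∈ (algebraMap ℚ ℝ).fieldRange) := by
  by_cases h12 : cost₁ μ ≤ cost₂ μ
  · have hmin : minCost μ = cost₁ μ := min_eq_left h12
    rw [hmin] at hC ⊢
    obtain ⟨hw, hcost⟩ := weights_cost₁ hN hμ hC
    refine ⟨_, _, _, _, _, _, hw, hcost, fun hq => ?_⟩
    obtain ⟨hs, -⟩ := parameters_rational hN hq
    exact ⟨div_mem (sub_mem (add_mem (natCast_mem _ _) (one_mem _)) hs) (natCast_mem _ _),
      div_mem (sub_mem hs (natCast_mem _ _)) (natCast_mem _ _), zero_mem _, zero_mem _⟩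
  · have hmin : minCost μ = cost₂ μ := min_eq_right (not_le.1 h12).le
    rw [hmin] at hC ⊢
    have hk : kk μ ≠ ⌊kk μ⌋₊ := fun hk => h12 (cost₁_le_cost₂ hN hμ hk)
    obtain ⟨⟨hα0, hα1⟩, ⟨hβ0, hβ1⟩, ⟨hδ0, hδ1⟩, hle, hsum, hr⟩ := fractions_feasible hN hμ hk hC
    have hceil := ceil_eq_floor_add_one (zero_le_one.trans (one_le_kk hN hμ)) hk
    obtain ⟨hw, hcost⟩ := weights_of_fractions hN hμ (one_le_floor_kk hN hμ) hα0 hα1 hβ0 hβ1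
      hδ0 hδ1 hle hsum hr (by rw [cost₂, hceil]) hC
    refine ⟨_, _, _, _, _, _, hw, hcost, fun hq => ?_⟩
    obtain ⟨-, hα, hβ, hδ⟩ := parameters_rational hN hq
    have h1 : (1 : ℝ) ∈ (algebraMap ℚ ℝ).fieldRange := one_mem _
    have hK : (⌊kk μ⌋₊ : ℝ) ∈ (algebraMap ℚ ℝ).fieldRange := natCast_mem _ _
    exact ⟨div_mem (mul_mem hα hβ) hK, div_mem (mul_mem hα (sub_mem h1 hβ)) hK,
      div_mem (mul_mem (sub_mem h1 hα) hδ) (add_mem hK h1),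
      div_mem (mul_mem (sub_mem h1 hα) (sub_mem h1 hδ)) (add_mem hK h1)⟩

end
end PRUW

end

theorem theorem1 (N : ℕ) (hN : 4 ≤ N) (μ : Fin N → ℝ)
    (hμ : ∀ n, 0 < μ n ∧ μ n ≤ 1)
    (hhet : ∃ m n, μ m ≠ μ n)
    (hC : PRUW.minCost μ ≠ ⊤) :
    ∃ q₀ : ℕ,
      ((∀ n, ∃ x : ℚ, μ n = x) →
        PRUW.AchievesUpTo μ (PRUW.minCost μ).toReal q₀ 0) ∧
      (∀ ε : ℝ, 0 < ε →
        PRUW.AchievesUpTo μ (PRUW.minCost μ).toReal q₀ ε) := by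
  obtain ⟨K, ρ, w₁, w₂, w₃, w₄, hw, hcost, hrat⟩ :=
    PRUW.exists_weights_minCost (by omega) hμ hC
  have hμ0 : ∀ n, 0 ≤ μ n := fun n => (hμ n).1.le
  refine ⟨N + N * N, fun hq => ?_, fun ε hε => ?_⟩
  · have hq' : ∀ n, μ n ∈ (algebraMap ℚ ℝ).fieldRange := fun n => by
      obtain ⟨x, hx⟩ := hq n
      exact ⟨x, by rw [hx, eq_ratCast]⟩
    obtain ⟨h₁, h₂, h₃, h₄⟩ := hrat hq'
    exact hcost ▸ hw.achievesUpTo_zero hμ0 hq' h₁ h₂ h₃ h₄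
  · exact hcost ▸ hw.achievesUpTo hμ0 hε
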